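/- Let $\Gamma$ be a torsion-free abelian group and let $E=\bigoplus_{\gamma\in\Gamma}E_\gamma$ be a graded division ring (every nonzero homogeneous element is invertible) that is finite-dimensional over its center $T=Z(E)$; let $\operatorname{ind}(E)$ be defined by $\operatorname{ind}(E)^2=[E:T]$. Let $\tau$ be a unitary graded involution on $E$, i.e. an anti-automorphism with $\tau^2=\mathrm{id}$, $\tau(E_\gamma)=E_\gamma$ for all $\gamma$, and $\tau|_T\neq\mathrm{id}$, and let $R=T^\tau=\{t\in T\mid\tau(t)=t\}$. For a graded subring $S$ write $S_0$ for its degree $0$ part, $S^*$ for its group of units and $\Gamma_S=\{\gamma\mid S\cap E_\gamma\ne 0\}$. A graded subfield of $E$ is a commutative graded subring in which all nonzero homogeneous elements are invertible. A graded subfield $S\supseteq T$ is unramified over $T$ if $\Gamma_S=\Gamma_T$ (equivalently, $S\cong S_0\otimes_{T_0}T$ as graded rings) and $S_0$ is separable over $T_0$; it is totally ramified over $T$ if $[S:T]=|\Gamma_S:\Gamma_T|$. Put $$SK_1(E,\tau)=\{a\in E^*\mid \operatorname{Nrd}_E(a\,\tau(a)^{-1})=1\}\,\big/\,\langle a\in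 E^*\mid \tau(a)=a\rangle ,$$ where $\operatorname{Nrd}_E$ is the reduced norm of $E$ (the restriction of the reduced norm of the ring of central quotients of $E$). Suppose that $T$ is unramified over $R$, i.e. $\Gamma_T=\Gamma_R$, and that $E$ has a maximal graded subfield $M$ unramified over $T$ and a maximal graded subfield $L$ totally ramified over $T$ with $\tau(L)=L$. Then $E$ is semiramified, i.e. $E_0$ is a field and $[E_0:T_0]=|\Gamma_E:\Gamma_T|=\operatorname{ind}(E)$; moreover $E_0=M_0$ and $\Gamma_E=\Gamma_L$, and $$SK_1(E,\tau)\ \cong\ \{a\in E_0^*\mid N_{E_0/T_0}(a)\in R_0\}\,\Big/\prod_{h\in\operatorname{Gal}(E_0/T_0)}E_0^{*h\bar\tau},$$ where $\bar\tau=\tau|_{E_0}$ and $E_0^{*h\bar\tau}=\{a\in E_0^*\mid h(\tau(a))=a\}$, and the product on the right is a subgroup of the group in the numerator. -/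

import Mathlib

open scoped TensorProduct

namespace UnitarySK

universe u v

section Preliminaries

/-- Torsion-free abelian groups have the unique sums property (they embed in `ℚ`-spaces). -/
theorem uniqueSums_of_torsionFree (Γ : Type*) [AddCommGroup Γ] [IsAddTorsionFree Γ] :
    UniqueSums Γ := by
  have hL : IsLocalizedModule (nonZeroDivisors ℤ) (TensorProduct.mk ℤ ℚ Γ 1) :=
    (isLocalizedModule_iff_isBaseChange (nonZeroDivisors ℤ) ℚ _).2
      (TensorProduct.isBaseChange ℤ Γ ℚ)
  have hinj : Function.Injective (TensorProduct.mk ℤ ℚ Γ 1) := by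
    intro x y hxy
    obtain ⟨c, hc⟩ := (IsLocalizedModule.eq_iff_exists (nonZeroDivisors ℤ) _).1 hxy
    have hc0 : (c : ℤ) ≠ 0 := nonZeroDivisors.coe_ne_zero c
    exact zsmul_right_injective hc0 hc
  have : TwoUniqueSums Γ :=
    TwoUniqueSums.of_injective_addHom
      ((TensorProduct.mk ℤ ℚ Γ 1).toAddMonoidHom : Γ →ₙ+ (ℚ ⊗[ℤ] Γ)) hinj inferInstance
  infer_instance

/-- A ring graded by a torsion-free group whose nonzero homogeneous elements are units has no
zero divisors. -/
theorem isDomain_of_grading {Γ E : Type*} [AddCommGroup Γ] [IsAddTorsionFree Γ] [DecidableEq Γ] [Ring E]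
    (𝒜 : Γ → AddSubgroup E) [GradedRing 𝒜] (hnt : Nontrivial E)
    (hu : ∀ (γ : Γ) (a : E), a ∈ 𝒜 γ → a ≠ 0 → IsUnit a) : IsDomain E := by
  classical
  have hus := uniqueSums_of_torsionFree Γ
  suffices NoZeroDivisors E from NoZeroDivisors.to_isDomain E
  refine ⟨fun {a b} hab => ?_⟩
  by_contra hcon
  push Not at hcon
  obtain ⟨ha, hb⟩ := hcon
  set r := DirectSum.decompose 𝒜 a with hr
  set s := DirectSum.decompose 𝒜 b with hs
  have hr0 : r ≠ 0 := fun h => ha ((DirectSum.decompose 𝒜).injective (h.trans (DirectSum.decompose_zero 𝒜).symm))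
  have hs0 : s ≠ 0 := fun h => hb ((DirectSum.decompose 𝒜).injective (h.trans (DirectSum.decompose_zero 𝒜).symm))
  have hA : r.support.Nonempty := by
    rw [Finset.nonempty_iff_ne_empty]; simpa using hr0
  have hB : s.support.Nonempty := by
    rw [Finset.nonempty_iff_ne_empty]; simpa using hs0
  obtain ⟨i, hi, j, hj, hij⟩ := UniqueSums.uniqueAdd_of_nonempty hA hB
  have h0 : ((r * s) (i + j) : E) = 0 := by
    rw [hr, hs, ← DirectSum.decompose_mul, hab]; simp
  rw [DirectSum.coe_mul_apply, Finset.sum_eq_single (i, j)] at h0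
  · have h1 : (r i : E) ≠ 0 := by simpa using (DFinsupp.mem_support_iff.1 hi)
    have h2 : (s j : E) ≠ 0 := by simpa using (DFinsupp.mem_support_iff.1 hj)
    exact h2 (((hu i _ (r i).2 h1).mul_right_eq_zero).1 h0)
  · rintro ⟨k, l⟩ hkl hne
    simp only [Finset.mem_filter, Finset.mem_product] at hkl
    obtain ⟨rfl, rfl⟩ := hij hkl.1.1 hkl.1.2 hkl.2
    exact absurd rfl hne
  · intro hne
    exact absurd (by simp only [Finset.mem_filter, Finset.mem_product]; exact ⟨⟨hi, hj⟩, trivial⟩) hne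

/-- A central division algebra stays simple after extension of scalars to a field. -/
theorem isSimpleRing_tensor (K F D : Type*) [Field K] [Field F] [Algebra K F] [Ring D] [Algebra K D]
    [Nontrivial D]
    (hu : ∀ d : D, d ≠ 0 → IsUnit d)
    (hc : ∀ d : D, (∀ e, d * e = e * d) → ∃ k : K, algebraMap K D k = d) :
    IsSimpleRing (D ⊗[K] F) := by
  classical
  let b := Module.Basis.ofVectorSpace K F
  let B := Algebra.TensorProduct.basis D b
  have hnt : Nontrivial (D ⊗[K] F) := by
    obtain ⟨i⟩ : Nonempty (Module.Basis.ofVectorSpaceIndex K F) := b.index_nonempty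
    exact ⟨B i, 0, B.ne_zero i⟩
  have hright : ∀ (x : D ⊗[K] F) (d : D) i,
      B.repr (x * (d ⊗ₜ[K] (1 : F))) i = B.repr x i * d := by
    intro x d i
    induction x using TensorProduct.induction_on with
    | zero => simp
    | add x y hx hy => rw [add_mul, map_add, map_add, Finsupp.add_apply, Finsupp.add_apply, hx, hy,
        add_mul]
    | tmul a f =>
      simp only [Algebra.TensorProduct.tmul_mul_tmul, mul_one, B,
        Algebra.TensorProduct.basis_repr_tmul, Finsupp.smul_apply, Finsupp.mapRange_apply,
        smul_eq_mul]
      rw [mul_assoc, mul_assoc, Algebra.commutes]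
  have hleft : ∀ (x : D ⊗[K] F) (d : D) i,
      B.repr ((d ⊗ₜ[K] (1 : F)) * x) i = d * B.repr x i := by
    intro x d i
    induction x using TensorProduct.induction_on with
    | zero => simp
    | add x y hx hy => rw [mul_add, map_add, map_add, Finsupp.add_apply, Finsupp.add_apply, hx, hy,
        mul_add]
    | tmul a f =>
      simp only [Algebra.TensorProduct.tmul_mul_tmul, one_mul, B,
        Algebra.TensorProduct.basis_repr_tmul, Finsupp.smul_apply, Finsupp.mapRange_apply,
        smul_eq_mul]
      rw [mul_assoc]
  have key : ∀ (n : ℕ) (I : TwoSidedIdeal (D ⊗[K] F)) (x : D ⊗[K] F), x ∈ I → x ≠ 0 →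
      (B.repr x).support.card = n → I = ⊤ := by
    intro n
    induction n using Nat.strong_induction_on with
    | _ n ih =>
      intro I x hx hx0 hn
      obtain ⟨i0, hi0⟩ : (B.repr x).support.Nonempty := by
        rw [Finset.nonempty_iff_ne_empty]; simpa using hx0
      obtain ⟨u, hu0⟩ := hu _ (Finsupp.mem_support_iff.1 hi0)
      set y : D ⊗[K] F := ((↑u⁻¹ : D) ⊗ₜ[K] (1 : F)) * x with hy
      have hyI : y ∈ I := I.mul_mem_left _ _ hx
      have hyr : ∀ i, B.repr y i = ↑u⁻¹ * B.repr x i := fun i => hleft x _ i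
      have hysupp : (B.repr y).support = (B.repr x).support := by
        ext i; simp [hyr]
      have hy1 : B.repr y i0 = 1 := by rw [hyr, ← hu0]; simp
      by_cases hcomm : ∀ (d : D) i, B.repr y i * d = d * B.repr y i
      · choose k hk using fun i => hc _ (fun d => hcomm d i)
        have hyf : ∃ f : F, y = (1 : D) ⊗ₜ[K] f := by
          refine ⟨∑ i ∈ (B.repr y).support, k i • b i, ?_⟩
          conv_lhs => rw [← B.linearCombination_repr y, Finsupp.linearCombination_apply,
            Finsupp.sum]
          rw [TensorProduct.tmul_sum]
          refine Finset.sum_congr rfl fun i _ => ?_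
          rw [← hk i, TensorProduct.tmul_smul, algebraMap_smul]
          simp [B]
        obtain ⟨f, hf⟩ := hyf
        have hf0 : f ≠ 0 := by
          rintro rfl
          rw [hf] at hy1
          simp at hy1
        have : (1 : D ⊗[K] F) ∈ I := by
          have h := I.mul_mem_left ((1 : D) ⊗ₜ[K] f⁻¹) _ hyI
          rw [hf, Algebra.TensorProduct.tmul_mul_tmul, inv_mul_cancel₀ hf0, one_mul] at h
          exact h
        exact (TwoSidedIdeal.one_mem_iff I).1 this
      · push Not at hcomm
        obtain ⟨d, i, hdi⟩ := hcomm
        let z : D ⊗[K] F := y * (d ⊗ₜ[K] (1 : F)) - (d ⊗ₜ[K] (1 : F)) * y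
        have hzr : ∀ i, B.repr z i = B.repr y i * d - d * B.repr y i := by
          intro i; simp only [z, map_sub, Finsupp.sub_apply, hright, hleft]
        have hzI : z ∈ I := I.sub_mem (I.mul_mem_right _ _ hyI) (I.mul_mem_left _ _ hyI)
        have hz0 : z ≠ 0 := by
          intro h
          have := hzr i
          rw [h] at this
          simp only [map_zero, Finsupp.coe_zero, Pi.zero_apply] at this
          exact hdi (sub_eq_zero.1 this.symm)
        refine ih _ ?_ I z hzI hz0 rfl
        rw [← hn, ← hysupp]
        refine Finset.card_lt_card ⟨fun j hj => ?_, fun hsub => ?_⟩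
        · rw [Finsupp.mem_support_iff, hzr] at hj
          rw [Finsupp.mem_support_iff]
          intro h0; rw [h0] at hj; simp at hj
        · have h1 := hsub (hysupp ▸ hi0)
          rw [Finsupp.mem_support_iff, hzr, hy1] at h1
          simp at h1
  refine ⟨⟨fun I => ?_⟩⟩
  by_cases h : ∃ x ∈ I, x ≠ 0
  · obtain ⟨x, hx, hx0⟩ := h
    exact Or.inr (key _ I x hx hx0 rfl)
  · push Not at h
    left
    rw [eq_bot_iff]
    intro x hx
    rw [h x hx]
    exact TwoSidedIdeal.zero_mem _


/-- If `E` is a domain that is finite over its centre `T`, then `E` is split by the algebraic closure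
`F` of the quotient field of `T`, that is, `F ⊗[T] E` is a matrix algebra over `F`. -/
theorem exists_splitting (E : Type*) [Ring E] [IsDomain E] [Module.Finite (Subring.center E) E] :
    ∃ n : ℕ, Nonempty (AlgebraicClosure (FractionRing (Subring.center E)) ⊗[Subring.center E] E
      ≃ₐ[AlgebraicClosure (FractionRing (Subring.center E))]
      Matrix (Fin n) (Fin n) (AlgebraicClosure (FractionRing (Subring.center E)))) := by
  let T := Subring.center E
  let K := FractionRing T
  let F := AlgebraicClosure K
  let D := K ⊗[T] E
  have hrep : ∀ x : D, ∃ (s : T) (e : E), s ≠ 0 ∧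
      (algebraMap T K s) • x = (1 : K) ⊗ₜ[T] e := by
    intro x
    induction x using TensorProduct.induction_on with
    | zero => exact ⟨1, 0, one_ne_zero, by simp⟩
    | tmul k e =>
      obtain ⟨⟨t, s⟩, hts⟩ := IsLocalization.surj (nonZeroDivisors T) k
      refine ⟨s, t • e, nonZeroDivisors.coe_ne_zero s, ?_⟩
      rw [TensorProduct.smul_tmul', smul_eq_mul, mul_comm, hts, ← TensorProduct.smul_tmul,
        Algebra.smul_def, mul_one]
    | add x y hx hy =>
      obtain ⟨s, e, hs, hx⟩ := hx
      obtain ⟨t, f, ht, hy⟩ := hy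
      refine ⟨s * t, t • e + s • f, mul_ne_zero hs ht, ?_⟩
      have h1 : (algebraMap T K (s * t)) • x = (1 : K) ⊗ₜ[T] (t • e) := by
        rw [map_mul, mul_comm, mul_smul, hx, TensorProduct.tmul_smul, algebraMap_smul]
      have h2 : (algebraMap T K (s * t)) • y = (1 : K) ⊗ₜ[T] (s • f) := by
        rw [map_mul, mul_smul, hy, TensorProduct.tmul_smul, algebraMap_smul]
      rw [smul_add, h1, h2, TensorProduct.tmul_add]
  have hinj : ∀ e : E, (1 : K) ⊗ₜ[T] e = (0 : D) → e = 0 := by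
    intro e he
    have hL : IsLocalizedModule (nonZeroDivisors T) (TensorProduct.mk T K E 1) :=
      (isLocalizedModule_iff_isBaseChange (nonZeroDivisors T) K _).2
        (TensorProduct.isBaseChange T E K)
    obtain ⟨c, hc⟩ := (IsLocalizedModule.eq_zero_iff (nonZeroDivisors T)
      (TensorProduct.mk T K E 1)).1 he
    have hc0 : ((c : T) : E) ≠ 0 := fun h => nonZeroDivisors.coe_ne_zero c (Subtype.ext h)
    exact (mul_eq_zero.1 (show ((c : T) : E) * e = 0 from hc)).resolve_left hc0
  have hsne : ∀ s : T, s ≠ 0 → algebraMap T K s ≠ 0 := fun s hs h =>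
    hs ((IsFractionRing.injective T K) (by rw [h, map_zero]))
  have hnt : Nontrivial D := ⟨1, 0, fun h => one_ne_zero (hinj 1 h)⟩
  have hdom : IsDomain D := by
    suffices NoZeroDivisors D from NoZeroDivisors.to_isDomain D
    refine ⟨fun {x y} hxy => ?_⟩
    obtain ⟨s, e, hs, hx⟩ := hrep x
    obtain ⟨t, f, ht, hy⟩ := hrep y
    have h : (1 : K) ⊗ₜ[T] (e * f) = (0 : D) := by
      have h1 : ((1 : K) ⊗ₜ[T] e) * ((1 : K) ⊗ₜ[T] f) = (0 : D) := by
        rw [← hx, ← hy, smul_mul_smul_comm, hxy, smul_zero]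
      simpa using h1
    rcases mul_eq_zero.1 (hinj _ h) with h0 | h0
    · left
      rw [h0, TensorProduct.tmul_zero] at hx
      exact (smul_eq_zero.1 hx).resolve_left (hsne s hs)
    · right
      rw [h0, TensorProduct.tmul_zero] at hy
      exact (smul_eq_zero.1 hy).resolve_left (hsne t ht)
  have hu : ∀ d : D, d ≠ 0 → IsUnit d := by
    intro d hd
    let _ := divisionRingOfFiniteDimensional K D
    exact IsUnit.mk0 d hd
  have hc : ∀ d : D, (∀ e, d * e = e * d) → ∃ k : K, algebraMap K D k = d := by
    intro d hd
    obtain ⟨s, e, hs, hx⟩ := hrep d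
    have he : e ∈ Subring.center E := by
      rw [Subring.mem_center_iff]
      intro f
      have h : (1 : K) ⊗ₜ[T] (f * e - e * f) = (0 : D) := by
        have h1 : ((1 : K) ⊗ₜ[T] f) * ((1 : K) ⊗ₜ[T] e) =
            (((1 : K) ⊗ₜ[T] e) * ((1 : K) ⊗ₜ[T] f) : D) := by
          rw [← hx, mul_smul_comm, smul_mul_assoc, hd]
        rw [TensorProduct.tmul_sub, sub_eq_zero]
        simpa using h1
      exact sub_eq_zero.1 (hinj _ h)
    refine ⟨(algebraMap T K s)⁻¹ * algebraMap T K ⟨e, he⟩, ?_⟩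
    have h2 : (1 : K) ⊗ₜ[T] e = algebraMap K D (algebraMap T K ⟨e, he⟩) := by
      have : e = (⟨e, he⟩ : T) • (1 : E) := by
        rw [Algebra.smul_def, mul_one]; rfl
      calc (1 : K) ⊗ₜ[T] e = (1 : K) ⊗ₜ[T] ((⟨e, he⟩ : T) • (1 : E)) := congrArg _ this
      _ = algebraMap K D (algebraMap T K ⟨e, he⟩) := by
        rw [← TensorProduct.smul_tmul, Algebra.smul_def, mul_one]; rfl
    rw [map_mul, ← h2, ← hx, ← Algebra.smul_def, inv_smul_smul₀ (hsne s hs)]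
  have hs1 : IsSimpleRing (D ⊗[K] F) := isSimpleRing_tensor K F D hu hc
  let e1 : F ⊗[T] E ≃ₐ[F] F ⊗[K] D := AlgEquiv.ofLinearEquiv
    (TensorProduct.AlgebraTensorModule.cancelBaseChange T K F F E).symm
    (by simp [Algebra.TensorProduct.one_def, D])
    (LinearMap.map_mul_of_map_mul_tmul (fun _ _ _ _ ↦ by simp [D]))
  have hs2 : IsSimpleRing (F ⊗[T] E) :=
    IsSimpleRing.of_ringEquiv (((Algebra.TensorProduct.comm K D F).toRingEquiv).trans e1.symm.toRingEquiv) hs1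
  obtain ⟨n, _, h⟩ := IsSimpleRing.exists_algEquiv_matrix_of_isAlgClosed F (F ⊗[T] E)
  exact ⟨n, h⟩

end Preliminaries

section ReducedNorm

variable (E : Type u) [Ring E] [IsDomain E] [Module.Finite (Subring.center E) E]

/-- An algebraic closure of the quotient field `q(T)` of the centre `T` of `E`. -/
abbrev SplitField : Type u := AlgebraicClosure (FractionRing (Subring.center E))

/-- The degree of a matrix algebra over `F` isomorphic to `F ⊗ E`; it equals `ind(E)`. -/
noncomputable def splitDegree : ℕ := (exists_splitting E).choose

/-- An isomorphism of `F`-algebras from `F ⊗ E` onto a matrix algebra over `F`. -/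
noncomputable def splitting : SplitField E ⊗[Subring.center E] E ≃ₐ[SplitField E]
    Matrix (Fin (splitDegree E)) (Fin (splitDegree E)) (SplitField E) :=
  Classical.choice (exists_splitting E).choose_spec

/-- The reduced norm of `E` (that is, the restriction to `E` of the reduced norm of its ring of
central quotients `q(E) = E ⊗ q(T)`), with values in an algebraic closure `F` of `q(T)`:
the determinant of the image of `1 ⊗ a` under an isomorphism of `F`-algebras `F ⊗ E ≃ Mₙ(F)`.
By Skolem-Noether it does not depend on the isomorphism. -/
noncomputable def reducedNorm : E →* SplitField E where
  toFun a := (splitting E ((1 : SplitField E) ⊗ₜ[Subring.center E] a)).det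
  map_one' := by rw [← Algebra.TensorProduct.one_def, map_one, Matrix.det_one]
  map_mul' a b := by
    rw [← Matrix.det_mul, ← map_mul, Algebra.TensorProduct.tmul_mul_tmul, one_mul]

end ReducedNorm

section Grading

variable {Γ : Type v} {E : Type u} [AddCommGroup Γ] [DecidableEq Γ] [Ring E]
  (𝒜 : Γ → AddSubgroup E) [GradedRing 𝒜]

/-- `E = ⨁ 𝒜 γ` is a graded division ring: the grading group is torsion-free and every nonzero
homogeneous element is invertible. -/
class IsGradedDivisionRing : Prop where
  torsionFree : IsAddTorsionFree Γ
  nontrivial : Nontrivial E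
  isUnit : ∀ (γ : Γ) (a : E), a ∈ 𝒜 γ → a ≠ 0 → IsUnit a

theorem IsGradedDivisionRing.isDomain [h : IsGradedDivisionRing 𝒜] : IsDomain E :=
  have := h.torsionFree
  isDomain_of_grading 𝒜 h.nontrivial h.isUnit

/-- A graded subfield of `E`: a commutative graded subring in which every nonzero homogeneous
element is invertible. -/
structure IsGradedSubfield (L : Subring E) : Prop where
  comm : ∀ x ∈ L, ∀ y ∈ L, x * y = y * x
  homogeneous : DirectSum.SetLike.IsHomogeneous 𝒜 L
  exists_inv : ∀ x ∈ L, SetLike.IsHomogeneousElem 𝒜 x → x ≠ 0 → ∃ y ∈ L, x * y = 1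

/-- The grade group `Γ_S` of a graded subring `S`, generated by the degrees `γ` with
`S ∩ 𝒜 γ ≠ 0`. (If nonzero homogeneous elements of `S` are invertible in `S`, these degrees
already form a subgroup.) -/
def gradeGroup (S : Subring E) : AddSubgroup Γ :=
  AddSubgroup.closure {γ | ∃ a ∈ S, a ∈ 𝒜 γ ∧ a ≠ 0}

/-- The degree zero subring `E₀`. -/
abbrev E₀ : Subring E := SetLike.GradeZero.subring 𝒜

/-- The degree zero part `T₀` of the centre `T` of `E`. -/
def T₀ : Subring E := Subring.center E ⊓ E₀ 𝒜

instance : CommRing (T₀ 𝒜) :=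
  { (inferInstance : Ring (T₀ 𝒜)) with
    mul_comm := fun a b => Subtype.ext ((Subring.mem_center_iff.1 b.2.1) a) }

instance : Algebra (T₀ 𝒜) (E₀ 𝒜) :=
  (Subring.inclusion (inf_le_right : T₀ 𝒜 ≤ E₀ 𝒜)).toAlgebra'
    (fun c x => Subtype.ext ((Subring.mem_center_iff.1 c.2.1) x).symm)

/-- A graded subfield `M` of `E` is unramified (inertial) over the centre `T`: `T ⊆ M`,
`Γ_M = Γ_T` and `M₀` is separable over `T₀`. The map `M₀ ⊗ T → M` is always injective with image
the sum of the components of `M` with degree in `Γ_T`, so `Γ_M = Γ_T` says that `M ≅ M₀ ⊗ T`. -/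
structure IsUnramifiedOverCenter (M : Subring E) : Prop where
  center_le : Subring.center E ≤ M
  gradeGroup_eq : gradeGroup 𝒜 M = gradeGroup 𝒜 (Subring.center E)
  separable : ∀ a : E₀ 𝒜, (a : E) ∈ M → IsSeparable (T₀ 𝒜) a

/-- A graded subfield `L` of `E` is totally ramified over the centre `T`: `T ⊆ L` and
`[L : T] = |Γ_L : Γ_T|`, where `[L : T]` is the rank of `L` as a `T`-module. -/
structure IsTotallyRamifiedOverCenter (L : Subring E) : Prop where
  center_le : Subring.center E ≤ L
  finrank_eq : Module.finrank (Subring.center E)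
      (Submodule.span (Subring.center E) (L : Set E)) =
    (gradeGroup 𝒜 (Subring.center E)).relIndex (gradeGroup 𝒜 L)

/-- The index of `E`, defined by `ind(E)² = [E : T]` where `T` is the centre. -/
noncomputable def ind (E : Type u) [Ring E] : ℕ := Nat.sqrt (Module.finrank (Subring.center E) E)

/-- `E` is semiramified: `E₀` is a field and `[E₀ : T₀] = |Γ_E : Γ_T| = ind(E)`. -/
structure IsSemiramified : Prop where
  isField : IsField (E₀ 𝒜)
  finrank_eq : Module.finrank (T₀ 𝒜) (E₀ 𝒜) =
    (gradeGroup 𝒜 (Subring.center E)).relIndex (gradeGroup 𝒜 ⊤)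
  relIndex_eq : (gradeGroup 𝒜 (Subring.center E)).relIndex (gradeGroup 𝒜 ⊤) = ind E

end Grading

section Involution

variable {Γ : Type v} {E : Type u} [AddCommGroup Γ] [DecidableEq Γ] [Ring E] [StarRing E]

/-- The fixed ring `R = T^τ` of the involution `τ = star` on the centre `T` of `E`. -/
def fixedCenter (E : Type u) [Ring E] [StarRing E] : Subring E where
  carrier := {t | t ∈ Subring.center E ∧ star t = t}
  mul_mem' := fun {a b} ha hb => ⟨mul_mem ha.1 hb.1, by
    rw [star_mul, ha.2, hb.2]; exact Subring.mem_center_iff.1 ha.1 b⟩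
  one_mem' := ⟨one_mem _, star_one E⟩
  add_mem' := fun ha hb => ⟨add_mem ha.1 hb.1, by rw [star_add, ha.2, hb.2]⟩
  zero_mem' := ⟨zero_mem _, star_zero E⟩
  neg_mem' := fun ha => ⟨neg_mem ha.1, by rw [star_neg, ha.2]⟩

/-- `Σ_τ(E)`, the subgroup of `E^*` generated by the units fixed by `τ = star`. (In a graded
division ring all units are homogeneous.) -/
def symSubgroup (E : Type u) [Ring E] [StarRing E] : Subgroup Eˣ :=
  Subgroup.closure {a | star a = a}

instance : (symSubgroup E).Normal where
  conj_mem := by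
    have key : ∀ a b : Eˣ, star a = a → b * a * b⁻¹ ∈ symSubgroup E := by
      intro a b ha
      have h : b * a * b⁻¹ = (b * a * star b) * (b * star b)⁻¹ := by group
      rw [h]
      refine mul_mem (Subgroup.subset_closure ?_) (inv_mem (Subgroup.subset_closure ?_))
      · simp [ha, mul_assoc]
      · simp
    intro n hn g
    induction hn using Subgroup.closure_induction with
    | mem x hx => exact key x g hx
    | one => simp
    | mul x y _ _ hx hy =>
      have := mul_mem hx hy
      simpa [mul_assoc] using this
    | inv x _ hx =>
      have := inv_mem hx
      simpa [mul_assoc] using this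

variable (𝒜 : Γ → AddSubgroup E) [GradedRing 𝒜]

/-- The involution `τ = star` is graded: `τ(E_γ) = E_γ` for every `γ`. -/
class IsGradedInvolution : Prop where
  star_mem : ∀ (γ : Γ) (a : E), a ∈ 𝒜 γ → star a ∈ 𝒜 γ

/-- `Σ'_τ(E) = {a ∈ E^* | Nrd(a τ(a)⁻¹) = 1}`. -/
noncomputable def nrdSubgroup [IsGradedDivisionRing 𝒜] [Module.Finite (Subring.center E) E] :
    Subgroup Eˣ :=
  haveI := IsGradedDivisionRing.isDomain 𝒜
  { carrier := {a | reducedNorm E (a * (star a)⁻¹ : Eˣ) = 1}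
    one_mem' := by simp
    mul_mem' := by
      intro a b ha hb
      simp only [Set.mem_ofPred_eq, Units.val_mul, map_mul] at ha hb ⊢
      rw [star_mul, mul_inv_rev, Units.val_mul, map_mul,
        mul_mul_mul_comm, ha, hb, one_mul]
    inv_mem' := by
      intro a ha
      simp only [Set.mem_ofPred_eq] at ha ⊢
      have h : reducedNorm E ((a * (star a)⁻¹ : Eˣ)) *
          reducedNorm E ((a⁻¹ * (star a⁻¹)⁻¹ : Eˣ)) = 1 := by
        rw [← map_mul, ← Units.val_mul, star_inv, inv_inv]
        simp only [Units.val_mul, map_mul]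
        have e1 : reducedNorm E (a : E) * reducedNorm E ((a⁻¹ : Eˣ) : E) = 1 := by
          rw [← map_mul, Units.mul_inv, map_one]
        have e2 : reducedNorm E ((star a : Eˣ) : E) *
            reducedNorm E (((star a)⁻¹ : Eˣ) : E) = 1 := by
          rw [← map_mul, Units.mul_inv, map_one]
        linear_combination (reducedNorm E ((star a : Eˣ) : E) *
            reducedNorm E (((star a)⁻¹ : Eˣ) : E)) * e1 + e2
      rwa [ha, one_mul] at h }

/-- The reduced unitary Whitehead group `SK₁(E, τ) = Σ'_τ(E) / Σ_τ(E)`. -/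
abbrev SK₁ [IsGradedDivisionRing 𝒜] [Module.Finite (Subring.center E) E] : Type u :=
  nrdSubgroup 𝒜 ⧸ (symSubgroup E).subgroupOf (nrdSubgroup 𝒜)

/-- The restriction `τ̄` of the graded involution `τ = star` to `E₀`. -/
def τ₀ [h : IsGradedInvolution 𝒜] (a : E₀ 𝒜) : E₀ 𝒜 := ⟨star (a : E), h.star_mem 0 a a.2⟩

/-- The subgroup of `E₀^*` generated by the `a` with `h(τ̄(a)) = a`, for `h ∈ Gal(E₀/T₀)`. If `E₀`
is commutative, these elements form a subgroup themselves, namely `E₀^{* h τ̄}`. -/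
def fixedUnits [IsGradedInvolution 𝒜] (h : E₀ 𝒜 ≃ₐ[T₀ 𝒜] E₀ 𝒜) : Subgroup (E₀ 𝒜)ˣ :=
  Subgroup.closure {a | h (τ₀ 𝒜 a) = a}

/-- The subgroup `∏_{h ∈ Gal(E₀/T₀)} E₀^{* h τ̄}` of `E₀^*`. -/
def prodFixedUnits [IsGradedInvolution 𝒜] : Subgroup (E₀ 𝒜)ˣ :=
  ⨆ h : E₀ 𝒜 ≃ₐ[T₀ 𝒜] E₀ 𝒜, fixedUnits 𝒜 h

/-- The subgroup `{a ∈ E₀^* | N_{E₀/T₀}(a) ∈ R₀}` of `E₀^*`. -/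
noncomputable def normSubgroup : Subgroup (E₀ 𝒜)ˣ where
  carrier := {a | ((Algebra.norm (T₀ 𝒜) (a : E₀ 𝒜) : T₀ 𝒜) : E) ∈ fixedCenter E}
  one_mem' := by simp
  mul_mem' := by
    intro a b ha hb
    simp only [Set.mem_ofPred_eq, Units.val_mul, map_mul, Subring.coe_mul] at ha hb ⊢
    exact mul_mem ha hb
  inv_mem' := by
    intro a ha
    simp only [Set.mem_ofPred_eq] at ha ⊢
    set x : T₀ 𝒜 := Algebra.norm (T₀ 𝒜) (a : E₀ 𝒜) with hx
    set y : T₀ 𝒜 := Algebra.norm (T₀ 𝒜) ((a⁻¹ : (E₀ 𝒜)ˣ) : E₀ 𝒜) with hy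
    have hxy : (x : E) * (y : E) = 1 := by
      have h : x * y = 1 := by rw [hx, hy, ← map_mul, Units.mul_inv, map_one]
      exact congrArg Subtype.val h
    have hsyx : star (y : E) * (x : E) = 1 := by
      have h := congrArg star hxy
      rwa [star_mul, star_one, ha.2] at h
    refine ⟨y.2.1, ?_⟩
    calc star (y : E) = star (y : E) * ((x : E) * (y : E)) := by rw [hxy, mul_one]
      _ = y := by rw [← mul_assoc, hsyx, one_mul]

end Involution

end UnitarySK

set_option linter.unusedSectionVars false

/-! Write `n = [E₀ : T₀]`. Two arguments of Artin-Dedekind type, both about conjugation by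
homogeneous units, give semiramification. Since `L` is totally ramified, `L₀ = T₀`; as `L` is its
own centralizer, the elements of `E₀` fixed under conjugation by `L^*` are those of `T₀`, and
Artin's argument gives `[E₀ : T₀] ≤ |Γ_L : Γ_T|` (`card_le_card_reps`). Since `M = M₀T` is its own
centralizer, representatives of `Γ_E / Γ_T` conjugate `M₀` into `E₀` by independent maps, and
Dedekind's argument gives `|Γ_E : Γ_T| ≤ [M₀ : T₀]` (`card_reps_le_card`). Together with `|Γ_L :
Γ_T| ≤ |Γ_E : Γ_T|` and `[M₀ : T₀] ≤ [E₀ : T₀]` this forces equality everywhere, so `E₀ = M₀` is a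
field, `Γ_E = Γ_L` and `[E : T] = n²`.

For `SK₁`, unramifiedness of `T` over `R` makes `τ` nontrivial on `T₀`, so `L` has a symmetric unit
in every degree of `Γ_L = Γ_E` (`exists_symmetric_unit`). The symmetric units of the commutative
ring `L` form a group `Z`, with `E^* = E₀^* Z`. Conjugation by `Z` realizes all of `Gal(E₀/T₀)`
(`exists_conjE₀_eq`), and `az` with `a ∈ E₀^*`, `z ∈ Z` is symmetric exactly when `a` is fixed by
`τ̄` followed by conjugation by `z`. Hence `Σ_τ(E) ∩ E₀^*` is the product of the groups `E₀^{*hτ̄}`.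
On `E₀` the reduced norm is `N_{E₀/T₀}` (`reducedNorm_coe_E₀`), so `Σ'_τ(E) ∩ E₀^*` is cut out by
`N(a) ∈ R₀`. As `Z ⊆ Σ_τ(E)`, every class of `SK₁` is represented in `E₀^*`, and the isomorphism
follows. -/

namespace UnitarySK

/-! ### Homogeneous units, centralizers and grade groups -/

section GradedDivision

variable {Γ E : Type*} [AddCommGroup Γ] [DecidableEq Γ] [Ring E]
  (𝒜 : Γ → AddSubgroup E) [GradedRing 𝒜]

variable {𝒜} in
theorem inv_mem_neg {u : Eˣ} {γ : Γ} (h : (u : E) ∈ 𝒜 γ) : ((u⁻¹ : Eˣ) : E) ∈ 𝒜 (-γ) := by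
  have h1 := DirectSum.coe_decompose_mul_add_of_left_mem 𝒜 (j := -γ) (b := ((u⁻¹ : Eˣ) : E)) h
  rw [Units.mul_inv, add_neg_cancel,
    DirectSum.decompose_of_mem_same 𝒜 SetLike.GradedOne.one_mem] at h1
  rw [Units.inv_eq_of_mul_eq_one_right h1.symm]
  exact SetLike.coe_mem _

variable {𝒜} in
theorem mul_inv_mem_sub {a : E} {u : Eˣ} {γ δ : Γ} (ha : a ∈ 𝒜 γ) (hu : (u : E) ∈ 𝒜 δ) :
    a * ((u⁻¹ : Eˣ) : E) ∈ 𝒜 (γ - δ) := by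
  rw [sub_eq_add_neg]
  exact SetLike.mul_mem_graded ha (inv_mem_neg hu)

variable {𝒜} in
theorem conj_mem {a : E} {u : Eˣ} {γ δ : Γ} (ha : a ∈ 𝒜 γ) (hu : (u : E) ∈ 𝒜 δ) :
    u * a * ((u⁻¹ : Eˣ) : E) ∈ 𝒜 γ := by
  have h := mul_inv_mem_sub (SetLike.mul_mem_graded hu ha) hu
  rwa [add_sub_cancel_left] at h

theorem exists_unit [h : IsGradedDivisionRing 𝒜] {a : E} {γ : Γ} (ha : a ∈ 𝒜 γ) (h0 : a ≠ 0) :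
    ∃ u : Eˣ, (u : E) = a :=
  h.isUnit γ a ha h0

/-- In a graded division ring every unit is homogeneous. -/
theorem isHomogeneousElem_unit [hE : IsGradedDivisionRing 𝒜] (u : Eˣ) :
    ∃ γ, (u : E) ∈ 𝒜 γ := by
  classical
  have := hE.torsionFree
  have := hE.nontrivial
  have hus := uniqueSums_of_torsionFree Γ
  have htus : TwoUniqueSums Γ := UniqueSums.toTwoUniqueSums_of_addGroup
  set r := DirectSum.decompose 𝒜 (u : E) with hr
  set s := DirectSum.decompose 𝒜 ((u⁻¹ : Eˣ) : E) with hs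
  have hne : ∀ v : Eˣ, (DirectSum.decompose 𝒜 (v : E)).support.Nonempty := by
    intro v
    rw [Finset.nonempty_iff_ne_empty]
    intro h
    rw [DFinsupp.support_eq_empty] at h
    exact v.ne_zero ((DirectSum.decompose 𝒜).injective
      (h.trans (DirectSum.decompose_zero 𝒜).symm))
  -- A pair of degrees whose sum is uniquely represented contributes an uncancelled nonzero
  -- component to `u * u⁻¹ = 1`, so the sum must be `0`.
  have key : ∀ p : Γ × Γ, p ∈ r.support ×ˢ s.support → UniqueAdd r.support s.support p.1 p.2 →
      p.1 + p.2 = 0 := by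
    rintro ⟨i, j⟩ hp hij
    rw [Finset.mem_product] at hp
    by_contra h0
    have h1 : ((r * s) (i + j) : E) = 0 := by
      rw [hr, hs, ← DirectSum.decompose_mul, Units.mul_inv,
        DirectSum.decompose_of_mem_ne 𝒜 SetLike.GradedOne.one_mem (Ne.symm h0)]
    rw [DirectSum.coe_mul_apply, Finset.sum_eq_single (i, j)] at h1
    · have h2 : (r i : E) ≠ 0 := by simpa using (DFinsupp.mem_support_iff.1 hp.1)
      have h3 : (s j : E) ≠ 0 := by simpa using (DFinsupp.mem_support_iff.1 hp.2)
      exact h3 (((hE.isUnit i _ (r i).2 h2).mul_right_eq_zero).1 h1)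
    · rintro ⟨k, l⟩ hkl hne
      simp only [Finset.mem_filter, Finset.mem_product] at hkl
      obtain ⟨rfl, rfl⟩ := hij hkl.1.1 hkl.1.2 hkl.2
      exact absurd rfl hne
    · intro hne
      exact absurd (by simp only [Finset.mem_filter, Finset.mem_product]
                       exact ⟨hp, trivial⟩) hne
  have hcard : r.support.card ≤ 1 := by
    by_contra hlt
    have hlt' : 1 < r.support.card * s.support.card := by
      have := Finset.card_pos.2 (hne u⁻¹)
      rw [← hs] at this
      nlinarith
    -- With more than one pair there are two distinct uniquely represented sums. Both equal `0`,
    -- which contradicts uniqueness.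
    obtain ⟨p, hp, q, hq, hpq, hup, huq⟩ := TwoUniqueSums.uniqueAdd_of_one_lt_card hlt'
    have h1 := key p hp hup
    have h2 := key q hq huq
    rw [Finset.mem_product] at hp hq
    obtain ⟨h3, h4⟩ := huq hp.1 hp.2 (h1.trans h2.symm)
    exact hpq (Prod.ext h3 h4)
  obtain ⟨γ, hγ⟩ := Finset.card_eq_one.1 (le_antisymm hcard (Finset.card_pos.2 (hne u)))
  refine ⟨γ, ?_⟩
  rw [← DirectSum.sum_support_decompose 𝒜 (u : E), ← hr, hγ, Finset.sum_singleton]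
  exact (r γ).2

/-- A graded subring that is closed under inverses of homogeneous elements. -/
structure IsGradedDivisionSubring (S : Subring E) : Prop where
  homogeneous : DirectSum.SetLike.IsHomogeneous 𝒜 S
  inv_mem : ∀ u : Eˣ, SetLike.IsHomogeneousElem 𝒜 (u : E) → (u : E) ∈ S → ((u⁻¹ : Eˣ) : E) ∈ S

variable {𝒜}

theorem isGradedDivisionSubring_top : IsGradedDivisionSubring 𝒜 (⊤ : Subring E) :=
  ⟨fun _ _ _ => trivial, fun _ _ _ => trivial⟩

theorem isGradedDivisionSubring_centralizer {s : Set E}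
    (hs : ∀ x ∈ s, SetLike.IsHomogeneousElem 𝒜 x) :
    IsGradedDivisionSubring 𝒜 (Subring.centralizer s) where
  homogeneous := by
    intro i m hm
    rw [Subring.mem_centralizer_iff] at hm
    refine Subring.mem_centralizer_iff.2 fun g hg => ?_
    obtain ⟨j, hj⟩ := hs g hg
    rw [← DirectSum.coe_decompose_mul_add_of_left_mem 𝒜 hj, hm g hg, add_comm,
      DirectSum.coe_decompose_mul_add_of_right_mem 𝒜 hj]
  inv_mem := by
    intro u _ hu
    rw [Subring.mem_centralizer_iff] at *
    exact fun g hg => Commute.units_inv_right (hu g hg)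

/-- A graded subring is additively generated by its homogeneous elements. With the preceding lemma
this makes its centralizer graded, and in particular the centre. -/
theorem centralizer_homogeneous_eq {S : Subring E} (hS : DirectSum.SetLike.IsHomogeneous 𝒜 S) :
    Subring.centralizer {x | x ∈ S ∧ SetLike.IsHomogeneousElem 𝒜 x} =
      Subring.centralizer (S : Set E) := by
  classical
  refine le_antisymm (fun y hy => ?_) (Subring.centralizer_le _ _ fun x hx => hx.1)
  rw [Subring.mem_centralizer_iff] at *
  intro g hg
  rw [← DirectSum.sum_support_decompose 𝒜 g, Finset.sum_mul, Finset.mul_sum]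
  exact Finset.sum_congr rfl fun i _ => hy _ ⟨hS i hg, i, SetLike.coe_mem _⟩

theorem isGradedDivisionSubring_center :
    IsGradedDivisionSubring 𝒜 (Subring.center E) := by
  have h : Subring.center E = Subring.centralizer
      {x | x ∈ (⊤ : Subring E) ∧ SetLike.IsHomogeneousElem 𝒜 x} := by
    rw [centralizer_homogeneous_eq (𝒜 := 𝒜) isGradedDivisionSubring_top.homogeneous]
    simp
  rw [h]
  exact isGradedDivisionSubring_centralizer fun x hx => hx.2

theorem IsGradedSubfield.isGradedDivisionSubring {S : Subring E} [Nontrivial E]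
    (hS : IsGradedSubfield 𝒜 S) : IsGradedDivisionSubring 𝒜 S where
  homogeneous := hS.homogeneous
  inv_mem u hu hS' := by
    obtain ⟨y, hy, h⟩ := hS.exists_inv _ hS' hu u.ne_zero
    rwa [Units.inv_eq_of_mul_eq_one_right h]

variable [IsGradedDivisionRing 𝒜]

theorem IsGradedDivisionSubring.mem_gradeGroup_iff {S : Subring E}
    (hS : IsGradedDivisionSubring 𝒜 S) {γ : Γ} :
    γ ∈ gradeGroup 𝒜 S ↔ ∃ u : Eˣ, (u : E) ∈ S ∧ (u : E) ∈ 𝒜 γ := by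
  have := IsGradedDivisionRing.nontrivial 𝒜
  constructor
  · intro h
    induction h using AddSubgroup.closure_induction with
    | mem x hx =>
      obtain ⟨a, haS, ha, h0⟩ := hx
      obtain ⟨u, rfl⟩ := exists_unit 𝒜 ha h0
      exact ⟨u, haS, ha⟩
    | zero => exact ⟨1, one_mem S, SetLike.GradedOne.one_mem⟩
    | add x y _ _ hx hy =>
      obtain ⟨u, hu, hu'⟩ := hx
      obtain ⟨v, hv, hv'⟩ := hy
      exact ⟨u * v, mul_mem hu hv, SetLike.mul_mem_graded hu' hv'⟩
    | neg x _ hx =>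
      obtain ⟨u, hu, hu'⟩ := hx
      exact ⟨u⁻¹, hS.inv_mem u ⟨_, hu'⟩ hu, inv_mem_neg hu'⟩
  · rintro ⟨u, hu, hu'⟩
    exact AddSubgroup.subset_closure ⟨u, hu, hu', u.ne_zero⟩

theorem mem_gradeGroup_of_mem {S : Subring E} {a : E} {γ : Γ} (ha : a ∈ S) (hγ : a ∈ 𝒜 γ)
    (h0 : a ≠ 0) : γ ∈ gradeGroup 𝒜 S :=
  AddSubgroup.subset_closure ⟨a, ha, hγ, h0⟩

theorem gradeGroup_mono {S S' : Subring E} (h : S ≤ S') : gradeGroup 𝒜 S ≤ gradeGroup 𝒜 S' :=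
  AddSubgroup.closure_mono fun _ ⟨a, ha, h'⟩ => ⟨a, h ha, h'⟩

/-- A maximal graded subfield is its own centralizer. -/
theorem centralizer_eq_of_maximal {S : Subring E} (hS : Maximal (IsGradedSubfield 𝒜) S) :
    Subring.centralizer (S : Set E) = S := by
  classical
  have := IsGradedDivisionRing.nontrivial 𝒜
  have hle : S ≤ Subring.centralizer (S : Set E) := fun x hx =>
    Subring.mem_centralizer_iff.2 fun y hy => hS.prop.comm y hy x hx
  refine le_antisymm ?_ hle
  have hhom : ∀ x ∈ Subring.centralizer (S : Set E), SetLike.IsHomogeneousElem 𝒜 x → x ∈ S := by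
    intro x hx hxh
    rw [Subring.mem_centralizer_iff] at hx
    -- The elements of `s` commute pairwise, so the double centralizer of `s` is commutative. It is
    -- graded because `s` is homogeneous, and it contains `S` and `x`; maximality of `S` then puts
    -- `x` in `S`.
    set s : Set E := insert x {y | y ∈ S ∧ SetLike.IsHomogeneousElem 𝒜 y} with hs
    have hsh : ∀ y ∈ s, SetLike.IsHomogeneousElem 𝒜 y := by
      rintro y (rfl | hy)
      exacts [hxh, hy.2]
    have hscomm : s ⊆ Subring.centralizer s := by
      intro y hy
      refine Subring.mem_centralizer_iff.2 fun z hz => ?_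
      rcases hy with rfl | hy <;> rcases hz with rfl | hz
      · rfl
      · exact hx z hz.1
      · exact (hx y hy.1).symm
      · exact hS.prop.comm z hz.1 y hy.1
    have hC := (isGradedDivisionSubring_centralizer hsh).homogeneous
    set C := Subring.centralizer s with hCdef
    have hCC : IsGradedDivisionSubring 𝒜 (Subring.centralizer (C : Set E)) := by
      rw [← centralizer_homogeneous_eq hC]
      exact isGradedDivisionSubring_centralizer fun x hx => hx.2
    have hsCC : s ⊆ Subring.centralizer (C : Set E) := fun y hy =>
      Subring.mem_centralizer_iff.2 fun z hz => (Subring.mem_centralizer_iff.1 hz y hy).symm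
    have hCCle : Subring.centralizer (C : Set E) ≤ C := Subring.centralizer_le _ _ hscomm
    have hfield : IsGradedSubfield 𝒜 (Subring.centralizer (C : Set E)) :=
      { comm := fun a ha b hb => Subring.mem_centralizer_iff.1 hb a (hCCle ha)
        homogeneous := hCC.homogeneous
        exists_inv := by
          rintro a ha ⟨i, hi⟩ h0
          obtain ⟨u, rfl⟩ := exists_unit 𝒜 hi h0
          exact ⟨_, hCC.inv_mem u ⟨i, hi⟩ ha, u.mul_inv⟩ }
    refine hS.le_of_ge hfield ?_ (hsCC (Set.mem_insert _ _))
    intro y hy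
    rw [← DirectSum.sum_support_decompose 𝒜 y]
    exact sum_mem fun i _ => hsCC (Set.mem_insert_of_mem _
      ⟨hS.prop.homogeneous i hy, i, SetLike.coe_mem _⟩)
  intro x hx
  have hC : DirectSum.SetLike.IsHomogeneous 𝒜 (Subring.centralizer (S : Set E)) := by
    rw [← centralizer_homogeneous_eq hS.prop.homogeneous]
    exact (isGradedDivisionSubring_centralizer fun x hx => hx.2).homogeneous
  rw [← DirectSum.sum_support_decompose 𝒜 x]
  exact sum_mem fun i _ => hhom _ (hC i hx) ⟨i, SetLike.coe_mem _⟩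

/-- Representatives in `S` of the cosets of `Γ_T` in `Γ_S`. -/
theorem IsGradedDivisionSubring.exists_reps {S : Subring E} (hS : IsGradedDivisionSubring 𝒜 S) :
    ∃ (g : gradeGroup 𝒜 S ⧸ (gradeGroup 𝒜 (Subring.center E)).addSubgroupOf (gradeGroup 𝒜 S) → Γ)
      (y : gradeGroup 𝒜 S ⧸ (gradeGroup 𝒜 (Subring.center E)).addSubgroupOf (gradeGroup 𝒜 S) → Eˣ),
      (∀ q, (y q : E) ∈ S) ∧ (∀ q, (y q : E) ∈ 𝒜 (g q)) ∧
      (∀ q q', g q - g q' ∈ gradeGroup 𝒜 (Subring.center E) → q = q') ∧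
      ∀ γ ∈ gradeGroup 𝒜 S, ∃ q, γ - g q ∈ gradeGroup 𝒜 (Subring.center E) := by
  choose y hyS hy using fun q : gradeGroup 𝒜 S ⧸
    (gradeGroup 𝒜 (Subring.center E)).addSubgroupOf (gradeGroup 𝒜 S) =>
      hS.mem_gradeGroup_iff.1 (Quotient.out q).2
  refine ⟨fun q => (Quotient.out q).1, y, hyS, hy, fun q q' h => ?_, fun γ hγ => ?_⟩
  · rw [← QuotientAddGroup.out_eq' q, ← QuotientAddGroup.out_eq' q', eq_comm, QuotientAddGroup.eq,
      AddSubgroup.mem_addSubgroupOf]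
    simpa [sub_eq_neg_add] using h
  · refine ⟨QuotientAddGroup.mk ⟨γ, hγ⟩, ?_⟩
    have h := QuotientAddGroup.out_eq' (QuotientAddGroup.mk (s :=
      (gradeGroup 𝒜 (Subring.center E)).addSubgroupOf (gradeGroup 𝒜 S)) ⟨γ, hγ⟩)
    rw [QuotientAddGroup.eq, AddSubgroup.mem_addSubgroupOf] at h
    simpa [sub_eq_neg_add] using h

end GradedDivision

/-! ### Bases of `E` over `T` from `E₀` and `Γ_E / Γ_T` -/

section Rank

variable {Γ E : Type*} [AddCommGroup Γ] [DecidableEq Γ] [Ring E]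
  (𝒜 : Γ → AddSubgroup E) [GradedRing 𝒜] [IsGradedDivisionRing 𝒜]

theorem isUnit_or_eq_zero_E₀ (a : E₀ 𝒜) : IsUnit a ∨ a = 0 := by
  refine or_iff_not_imp_right.2 fun h0 => ?_
  obtain ⟨u, hu⟩ := exists_unit 𝒜 a.2 (fun h => h0 (Subtype.ext h))
  have h1 : ((u⁻¹ : Eˣ) : E) ∈ 𝒜 0 := by
    have := inv_mem_neg (𝒜 := 𝒜) (u := u) (hu ▸ a.2)
    rwa [neg_zero] at this
  exact ⟨⟨a, ⟨_, h1⟩, Subtype.ext (by simp [← hu]), Subtype.ext (by simp [← hu])⟩, rfl⟩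

theorem isUnit_or_eq_zero_T₀ (a : T₀ 𝒜) : IsUnit a ∨ a = 0 := by
  refine or_iff_not_imp_right.2 fun h0 => ?_
  obtain ⟨u, hu⟩ := exists_unit 𝒜 a.2.2 (fun h => h0 (Subtype.ext h))
  have h1 : ((u⁻¹ : Eˣ) : E) ∈ 𝒜 0 := by
    have := inv_mem_neg (𝒜 := 𝒜) (u := u) (hu ▸ a.2.2)
    rwa [neg_zero] at this
  have h2 : ((u⁻¹ : Eˣ) : E) ∈ Subring.center E :=
    isGradedDivisionSubring_center.inv_mem u ⟨0, hu ▸ a.2.2⟩ (hu ▸ a.2.1)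
  exact ⟨⟨a, ⟨_, h2, h1⟩, Subtype.ext (by simp [← hu]), Subtype.ext (by simp [← hu])⟩, rfl⟩

/-- The degree zero part of a graded division ring is a division ring. -/
noncomputable abbrev divisionRingE₀ : DivisionRing (E₀ 𝒜) :=
  have := IsGradedDivisionRing.nontrivial 𝒜
  DivisionRing.ofIsUnitOrEqZero (isUnit_or_eq_zero_E₀ 𝒜)

/-- The degree zero part of the centre of a graded division ring is a field. -/
noncomputable abbrev fieldT₀ : Field (T₀ 𝒜) :=
  have := IsGradedDivisionRing.nontrivial 𝒜
  Field.ofIsUnitOrEqZero (isUnit_or_eq_zero_T₀ 𝒜)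

attribute [local instance] divisionRingE₀ fieldT₀

variable {𝒜}

theorem coe_smul_E₀ (s : T₀ 𝒜) (e : E₀ 𝒜) : ((s • e : E₀ 𝒜) : E) = (s : E) * e := rfl

/-- Degrees modulo `Γ_T` separate the different `y k`, so a homogeneous component of a `T`-relation
involves a single `k`. Dividing by a homogeneous central unit turns it into a `T₀`-relation among
the `b i`. -/
theorem linearIndependent_mul {ι κ : Type*} {b : ι → E₀ 𝒜} (hb : LinearIndependent (T₀ 𝒜) b)
    {y : κ → Eˣ} {g : κ → Γ} (hy : ∀ k, (y k : E) ∈ 𝒜 (g k))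
    (hg : ∀ k k', g k - g k' ∈ gradeGroup 𝒜 (Subring.center E) → k = k') :
    LinearIndependent (Subring.center E) (fun p : ι × κ => (b p.1 : E) * y p.2) := by
  classical
  have hcent := (isGradedDivisionSubring_center (𝒜 := 𝒜))
  rw [linearIndependent_iff']
  rintro s c hsum ⟨i₀, k₀⟩ hp
  have hcomp : ∀ γ, (DirectSum.decompose 𝒜 (c (i₀, k₀) : E) γ : E) = 0 := by
    intro γ
    by_contra h0
    -- The divisor is the component of the coefficient under study, so after division the
    -- coefficient of `b i₀` is `1`.
    obtain ⟨r, hr⟩ := exists_unit 𝒜 (SetLike.coe_mem _) h0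
    have hrγ : (r : E) ∈ 𝒜 γ := hr ▸ SetLike.coe_mem _
    have hrT : (r : E) ∈ Subring.center E := hr ▸ hcent.homogeneous γ (c (i₀, k₀)).2
    have h1 := congrArg (fun x => (DirectSum.decompose 𝒜 x (γ + g k₀) : E)) hsum
    simp only [DirectSum.decompose_sum, DirectSum.sum_apply, AddSubmonoidClass.coe_finsetSum,
      DirectSum.decompose_zero, DirectSum.zero_apply, ZeroMemClass.coe_zero,
      Subring.smul_def, smul_eq_mul] at h1
    have h2 : ∀ p ∈ s, (DirectSum.decompose 𝒜 ((c p : E) * (b p.1 * y p.2)) (γ + g k₀) : E) =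
        if p.2 = k₀ then (DirectSum.decompose 𝒜 (c p : E) γ : E) * b p.1 * y k₀ else 0 := by
      rintro ⟨i, k⟩ -
      have hm : (b i : E) * y k ∈ 𝒜 (g k) := by
        simpa using SetLike.mul_mem_graded (show (b i : E) ∈ 𝒜 0 from (b i).2) (hy k)
      have h3 := DirectSum.coe_decompose_mul_add_of_right_mem 𝒜 (i := γ + g k₀ - g k)
        (a := (c (i, k) : E)) hm
      rw [sub_add_cancel] at h3
      rw [h3]
      split_ifs with hk
      · simp only at hk
        subst hk
        rw [add_sub_cancel_right, mul_assoc]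
      · suffices (DirectSum.decompose 𝒜 (c (i, k) : E) (γ + g k₀ - g k) : E) = 0 by
          rw [this, zero_mul]
        by_contra hne
        have h4 := mem_gradeGroup_of_mem (hcent.homogeneous _ (c (i, k)).2) (SetLike.coe_mem _) hne
        have h5 := sub_mem h4 (mem_gradeGroup_of_mem hrT hrγ (hr ▸ h0))
        rw [add_sub_assoc, add_sub_cancel_left] at h5
        exact hk (hg _ _ h5).symm
    rw [Finset.sum_congr rfl h2, ← Finset.sum_filter, ← Finset.sum_mul,
      Units.mul_left_eq_zero] at h1
    have hd : ∀ p : ι × κ, (DirectSum.decompose 𝒜 (c p : E) γ : E) * ((r⁻¹ : Eˣ) : E) ∈ T₀ 𝒜 := by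
      intro p
      refine ⟨mul_mem (hcent.homogeneous _ (c p).2) (hcent.inv_mem r ⟨γ, hrγ⟩ hrT), ?_⟩
      have := mul_inv_mem_sub (SetLike.coe_mem (DirectSum.decompose 𝒜 (c p : E) γ)) hrγ
      rwa [sub_self] at this
    have h6 := linearIndependent_iff'.1 hb ((s.filter (·.2 = k₀)).image Prod.fst)
      (fun i => ⟨_, hd (i, k₀)⟩) ?_ i₀ ?_
    · have h7 := congrArg Subtype.val h6
      simp only [← hr, Units.mul_inv, ZeroMemClass.coe_zero] at h7
      have := IsGradedDivisionRing.nontrivial 𝒜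
      exact one_ne_zero h7
    · rw [Finset.sum_image]
      · apply Subtype.ext
        simp only [AddSubmonoidClass.coe_finsetSum, coe_smul_E₀, ZeroMemClass.coe_zero]
        rw [← mul_zero ((r⁻¹ : Eˣ) : E), ← h1, Finset.mul_sum]
        refine Finset.sum_congr rfl fun p hp => ?_
        obtain ⟨i, k⟩ := p
        have hk : k = k₀ := (Finset.mem_filter.1 hp).2
        subst hk
        rw [← mul_assoc]
        congr 1
        exact (Subring.mem_center_iff.1 (hcent.inv_mem r ⟨γ, hrγ⟩ hrT) _)
      · rintro ⟨i, k⟩ hik ⟨i', k'⟩ hik' h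
        have hk : k = k₀ := (Finset.mem_filter.1 hik).2
        have hk' : k' = k₀ := (Finset.mem_filter.1 hik').2
        exact Prod.ext h (hk.trans hk'.symm)
    · exact Finset.mem_image.2 ⟨(i₀, k₀), Finset.mem_filter.2 ⟨hp, rfl⟩, rfl⟩
  apply Subtype.ext
  rw [← DirectSum.sum_support_decompose 𝒜 (c (i₀, k₀) : E)]
  exact Finset.sum_eq_zero fun i _ => hcomp i

theorem span_mul_eq_top {ι κ : Type*} (b : Module.Basis ι (T₀ 𝒜) (E₀ 𝒜))
    {y : κ → Eˣ} {g : κ → Γ} (hy : ∀ k, (y k : E) ∈ 𝒜 (g k))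
    (hg : ∀ γ ∈ gradeGroup 𝒜 (⊤ : Subring E), ∃ k,
      γ - g k ∈ gradeGroup 𝒜 (Subring.center E)) :
    ⊤ ≤ Submodule.span (Subring.center E)
      (Set.range (fun p : ι × κ => (b p.1 : E) * y p.2)) := by
  classical
  set N := Submodule.span (Subring.center E)
      (Set.range (fun p : ι × κ => (b p.1 : E) * y p.2)) with hN
  have hcent := (isGradedDivisionSubring_center (𝒜 := 𝒜))
  have h1 : ∀ (e : E₀ 𝒜) k, (e : E) * y k ∈ N := by
    intro e k
    induction b.mem_span e using Submodule.span_induction with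
    | mem x hx =>
      obtain ⟨i, rfl⟩ := hx
      exact Submodule.subset_span ⟨(i, k), rfl⟩
    | zero => simp
    | add x z _ _ hx hz =>
      rw [Subring.coe_add, add_mul]
      exact add_mem hx hz
    | smul s x _ hx =>
      rw [coe_smul_E₀, mul_assoc]
      exact N.smul_mem (⟨s, s.2.1⟩ : Subring.center E) hx
  intro x _
  rw [← DirectSum.sum_support_decompose 𝒜 x]
  refine sum_mem fun γ _ => ?_
  by_cases h0 : (DirectSum.decompose 𝒜 x γ : E) = 0
  · rw [h0]; exact zero_mem _
  obtain ⟨k, hk⟩ := hg γ (mem_gradeGroup_of_mem trivial (SetLike.coe_mem _) h0)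
  obtain ⟨r, hrT, hr⟩ := hcent.mem_gradeGroup_iff.1 hk
  -- A homogeneous element whose degree is congruent to `g k` modulo `Γ_T` factors as a central unit
  -- times an element of `E₀` times `y k`.
  have hm : ((r⁻¹ : Eˣ) : E) * (DirectSum.decompose 𝒜 x γ : E) * ((y k)⁻¹ : Eˣ) ∈ 𝒜 0 := by
    have := mul_inv_mem_sub (SetLike.mul_mem_graded (inv_mem_neg hr)
      (SetLike.coe_mem (DirectSum.decompose 𝒜 x γ))) (hy k)
    rwa [neg_sub, sub_add_cancel, sub_self] at this
  have h2 := N.smul_mem (⟨r, hrT⟩ : Subring.center E) (h1 ⟨_, hm⟩ k)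
  rw [Subring.smul_def, smul_eq_mul] at h2
  simpa [mul_assoc] using h2

theorem linearIndependent_coe_E₀ {ι : Type*} {b : ι → E₀ 𝒜}
    (hb : LinearIndependent (T₀ 𝒜) b) :
    LinearIndependent (Subring.center E) (fun i => (b i : E)) := by
  have h := linearIndependent_mul (κ := Unit) hb (y := fun _ => 1) (g := fun _ => 0)
    (fun _ => SetLike.GradedOne.one_mem) (fun _ _ _ => rfl)
  simpa [Function.comp_def] using h.comp (fun i => (i, ())) (fun i j h => (Prod.ext_iff.1 h).1)

theorem linearIndependent_reps {κ : Type*} {y : κ → Eˣ} {g : κ → Γ}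
    (hy : ∀ k, (y k : E) ∈ 𝒜 (g k))
    (hg : ∀ k k', g k - g k' ∈ gradeGroup 𝒜 (Subring.center E) → k = k') :
    LinearIndependent (Subring.center E) (fun k => (y k : E)) := by
  have h1 : LinearIndependent (T₀ 𝒜) (fun _ : Unit => (1 : E₀ 𝒜)) :=
    LinearIndependent.of_subsingleton () one_ne_zero
  have h := linearIndependent_mul h1 hy hg
  simpa [Function.comp_def] using h.comp (fun i => ((), i)) (fun i j h => (Prod.ext_iff.1 h).2)

variable [Module.Finite (Subring.center E) E]

variable (𝒜) in
theorem finite_E₀ : Module.Finite (T₀ 𝒜) (E₀ 𝒜) := by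
  have := IsGradedDivisionRing.nontrivial 𝒜
  have := IsGradedDivisionRing.isDomain 𝒜
  let b := Module.Basis.ofVectorSpace (T₀ 𝒜) (E₀ 𝒜)
  have := (linearIndependent_coe_E₀ b.linearIndependent).finite
  exact Module.Finite.of_basis b

theorem finite_reps {κ : Type*} {y : κ → Eˣ} {g : κ → Γ}
    (hy : ∀ k, (y k : E) ∈ 𝒜 (g k))
    (hg : ∀ k k', g k - g k' ∈ gradeGroup 𝒜 (Subring.center E) → k = k') : Finite κ := by
  have := IsGradedDivisionRing.nontrivial 𝒜
  have := IsGradedDivisionRing.isDomain 𝒜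
  exact (linearIndependent_reps hy hg).finite

end Rank

/-! ### Relations of minimal support -/

section MinimalRelation

/-- Normalize a nonzero vector of smallest support at one coordinate `j`. A vector supported there
and vanishing at `j` has smaller support. Both independence arguments below use this. -/
theorem exists_minimal_relation {D J : Type*} [DivisionRing D] {W : Submodule D (J →₀ D)}
    (hW : W ≠ ⊥) : ∃ w ∈ W, ∃ j, w j = 1 ∧
      ∀ w' ∈ W, w'.support ⊆ w.support → w' j = 0 → w' = 0 := by
  obtain ⟨w, ⟨hw, hw0⟩, hmin⟩ := (measure fun w : J →₀ D => w.support.card).wf.has_min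
    {w | w ∈ W ∧ w ≠ 0} ((Submodule.ne_bot_iff _).1 hW)
  obtain ⟨j, hj⟩ := Finsupp.ne_iff.1 hw0
  rw [Finsupp.zero_apply] at hj
  have hsupp : ((w j)⁻¹ • w).support = w.support := by
    ext i
    simp [hj]
  refine ⟨(w j)⁻¹ • w, W.smul_mem _ hw, j, by simp [hj], fun w' hw' hs h0 => ?_⟩
  by_contra hne
  rw [hsupp] at hs
  refine hmin w' ⟨hw', hne⟩ (Finset.card_lt_card ⟨hs, fun h => ?_⟩)
  exact Finsupp.mem_support_iff.1 (h (Finsupp.mem_support_iff.2 hj)) h0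

end MinimalRelation

/-! ### Conjugation on `E₀` and the two index inequalities -/

section Conjugation

variable {Γ E : Type*} [AddCommGroup Γ] [DecidableEq Γ] [Ring E]
  (𝒜 : Γ → AddSubgroup E) [GradedRing 𝒜] [IsGradedDivisionRing 𝒜]

/-- The action of `E^*` on `E₀` by conjugation. -/
def conjE₀ : Eˣ →* (E₀ 𝒜 ≃ₐ[T₀ 𝒜] E₀ 𝒜) where
  toFun u :=
    { toFun := fun e => ⟨u * e * ((u⁻¹ : Eˣ) : E),
        (isHomogeneousElem_unit 𝒜 u).elim fun _ h => conj_mem (𝒜 := 𝒜) e.2 h⟩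
      invFun := fun e => ⟨((u⁻¹ : Eˣ) : E) * e * u,
        (isHomogeneousElem_unit 𝒜 u⁻¹).elim fun _ h => by
          show _ ∈ 𝒜 0
          simpa using conj_mem (𝒜 := 𝒜) e.2 h⟩
      left_inv := fun e => Subtype.ext (by simp [mul_assoc])
      right_inv := fun e => Subtype.ext (by simp [mul_assoc])
      map_mul' := fun a b => Subtype.ext (by simp [mul_assoc])
      map_add' := fun a b => Subtype.ext (by simp [mul_add, add_mul])
      commutes' := fun s => Subtype.ext (by
        show (u : E) * (s : E) * ((u⁻¹ : Eˣ) : E) = s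
        rw [Subring.mem_center_iff.1 s.2.1, mul_assoc, Units.mul_inv, mul_one]) }
  map_one' := AlgEquiv.ext fun e => Subtype.ext (by simp)
  map_mul' u v := AlgEquiv.ext fun e => Subtype.ext (by simp [mul_assoc])

variable {𝒜}

theorem coe_conjE₀ (u : Eˣ) (e : E₀ 𝒜) :
    (conjE₀ 𝒜 u e : E) = u * e * ((u⁻¹ : Eˣ) : E) := rfl

theorem conjE₀_eq_self_iff {u : Eˣ} {e : E₀ 𝒜} : conjE₀ 𝒜 u e = e ↔ (u : E) * e = e * u := by
  rw [← Subtype.coe_inj, coe_conjE₀, Units.mul_inv_eq_iff_eq_mul]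

theorem conjE₀_of_mem_center {u : Eˣ} (h : (u : E) ∈ Subring.center E) : conjE₀ 𝒜 u = 1 :=
  AlgEquiv.ext fun e => conjE₀_eq_self_iff.2 (Subring.mem_center_iff.1 h e).symm

attribute [local instance] divisionRingE₀ fieldT₀

/-- If `S` is a self-centralizing graded subring with `S₀ = T₀`, then `[E₀ : T₀] ≤ |Γ_S : Γ_T|`. -/
theorem card_le_card_reps {S : Subring E} (hS : IsGradedDivisionSubring 𝒜 S)
    (hC : Subring.centralizer (S : Set E) ≤ S) (hS₀ : ∀ a ∈ S, a ∈ 𝒜 0 → a ∈ Subring.center E)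
    {ι κ : Type*} [Finite ι] [Finite κ] {b : ι → E₀ 𝒜} (hb : LinearIndependent (T₀ 𝒜) b)
    {y : κ → Eˣ} {g : κ → Γ} (hyS : ∀ k, (y k : E) ∈ S) (hy : ∀ k, (y k : E) ∈ 𝒜 (g k))
    (hg : ∀ γ ∈ gradeGroup 𝒜 S, ∃ k, γ - g k ∈ gradeGroup 𝒜 (Subring.center E)) :
    Nat.card ι ≤ Nat.card κ := by
  classical
  have hcent := (isGradedDivisionSubring_center (𝒜 := 𝒜))
  have hTS : Subring.center E ≤ S := (Subring.center_le_centralizer _).trans hC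
  -- All units of `S` are used here, not only representatives, so that the relations are stable
  -- under translation by `S^*`.
  let X := {l : Eˣ // (l : E) ∈ S}
  let v : ι → X → E₀ 𝒜 := fun i l => conjE₀ 𝒜 l.1 (b i)
  have hv : LinearIndependent (E₀ 𝒜) v := by
    rw [LinearIndependent, ← LinearMap.ker_eq_bot]
    by_contra hne
    obtain ⟨w, hw, j, hj, hmin⟩ := exists_minimal_relation hne
    have hrel : ∀ w : ι →₀ E₀ 𝒜, w ∈ LinearMap.ker (Finsupp.linearCombination (E₀ 𝒜) v) ↔
        ∀ l : Eˣ, (l : E) ∈ S → ∑ i ∈ w.support, w i * conjE₀ 𝒜 l (b i) = 0 := by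
      intro w
      rw [LinearMap.mem_ker, Finsupp.linearCombination_apply, Finsupp.sum, funext_iff]
      simp only [Finset.sum_apply, Pi.smul_apply, Pi.zero_apply, smul_eq_mul, v, X, Subtype.forall]
    -- Conjugating the minimal relation by `l` gives a relation with the same support and the same
    -- coefficient `1` at `j`, hence the same relation.
    have hcomm : ∀ l : Eˣ, (l : E) ∈ S → ∀ i, conjE₀ 𝒜 l (w i) = w i := by
      intro l hl
      let w₁ : ι →₀ E₀ 𝒜 := w.mapRange (conjE₀ 𝒜 l) (map_zero _)
      have hsupp : w₁.support = w.support := Finsupp.support_mapRange_of_injective _ _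
        (conjE₀ 𝒜 l).injective
      have h1 : w₁ ∈ LinearMap.ker (Finsupp.linearCombination (E₀ 𝒜) v) := by
        rw [hrel]
        intro l' hl'
        have hlinv := hS.inv_mem l (isHomogeneousElem_unit 𝒜 l) hl
        have h2 := congrArg (conjE₀ 𝒜 l) ((hrel w).1 hw (l⁻¹ * l') (mul_mem hlinv hl'))
        rw [map_zero, map_sum] at h2
        rw [hsupp, ← h2]
        refine Finset.sum_congr rfl fun i _ => ?_
        rw [map_mul, ← AlgEquiv.mul_apply, ← map_mul, mul_inv_cancel_left]
        rfl
      have h2 := hmin (w₁ - w) (sub_mem h1 hw) ?_ ?_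
      · intro i
        exact sub_eq_zero.1 (DFunLike.congr_fun h2 i)
      · exact Finsupp.support_sub.trans (by rw [hsupp, Finset.union_self])
      · rw [Finsupp.sub_apply, Finsupp.mapRange_apply, hj, map_one, sub_self]
    have hwT : ∀ i, (w i : E) ∈ T₀ 𝒜 := by
      intro i
      refine ⟨hS₀ _ (hC ?_) (w i).2, (w i).2⟩
      rw [← centralizer_homogeneous_eq hS.homogeneous, Subring.mem_centralizer_iff]
      rintro x ⟨hxS, γ, hx⟩
      by_cases h0 : x = 0
      · simp [h0]
      obtain ⟨u, rfl⟩ := exists_unit 𝒜 hx h0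
      exact conjE₀_eq_self_iff.1 (hcomm u hxS i)
    -- The coefficients lie in `T₀`; at `l = 1` the relation becomes a `T₀`-relation among the `b
    -- i`.
    have h1 := (hrel w).1 hw 1 (one_mem S)
    have h2 := linearIndependent_iff'.1 hb w.support (fun i => ⟨w i, hwT i⟩) ?_ j ?_
    · have h3 : w j = 0 := Subtype.ext (congrArg (fun x : T₀ 𝒜 => (x : E)) h2)
      exact one_ne_zero (hj.symm.trans h3)
    · rw [map_one] at h1
      exact h1
    · rw [Finsupp.mem_support_iff, hj]
      exact one_ne_zero
  -- Since `S₀ = T₀`, a unit of `S` differs from some `y k` by a central unit, so the independent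
  -- vectors already live in a space of dimension `|κ|`.
  have hred : ∀ l : X, ∃ k, conjE₀ 𝒜 l.1 = conjE₀ 𝒜 (y k) := by
    rintro ⟨l, hl⟩
    obtain ⟨γ, hγ⟩ := isHomogeneousElem_unit 𝒜 l
    obtain ⟨k, hk⟩ := hg γ (hS.mem_gradeGroup_iff.2 ⟨l, hl, hγ⟩)
    obtain ⟨r, hrT, hr⟩ := hcent.mem_gradeGroup_iff.1 hk
    refine ⟨k, ?_⟩
    have hm : ((l * (y k)⁻¹ * r⁻¹ : Eˣ) : E) ∈ Subring.center E := by
      apply hS₀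
      · push_cast
        exact mul_mem (mul_mem hl (hS.inv_mem _ ⟨_, hy k⟩ (hyS k)))
          (hTS (hcent.inv_mem r ⟨_, hr⟩ hrT))
      · have := mul_inv_mem_sub (mul_inv_mem_sub hγ (hy k)) hr
        rwa [sub_self] at this
    have h1 := conjE₀_of_mem_center (𝒜 := 𝒜) hm
    have h2 := conjE₀_of_mem_center (𝒜 := 𝒜) hrT
    rwa [map_mul, map_mul, map_inv, map_inv, h2, inv_one, mul_one, mul_inv_eq_one] at h1
  choose π hπ using hred
  have hv' : LinearIndependent (E₀ 𝒜) (fun i k => conjE₀ 𝒜 (y k) (b i)) := by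
    refine LinearIndependent.of_comp (LinearMap.funLeft (E₀ 𝒜) (E₀ 𝒜) π) ?_
    convert hv using 1
    ext i l
    simp [v, hπ]
  have := Fintype.ofFinite ι
  have := Fintype.ofFinite κ
  have h := hv'.fintype_card_le_finrank
  rwa [Module.finrank_pi, ← Nat.card_eq_fintype_card, ← Nat.card_eq_fintype_card] at h

/-- The degree zero part of a graded subring `S ⊇ T`, as a `T₀`-subspace of `E₀`. -/
def degreeZeroPart {S : Subring E} (hS : Subring.center E ≤ S) : Submodule (T₀ 𝒜) (E₀ 𝒜) where
  carrier := {e | (e : E) ∈ S}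
  add_mem' := fun ha hb => add_mem (S := Subring E) ha hb
  zero_mem' := zero_mem S
  smul_mem' := fun c _ hx => mul_mem (hS c.2.1) hx

/-- Because `Γ_S = Γ_T`, each nonzero homogeneous element of `S` is a degree zero element of `S`
times a central unit. -/
theorem mem_centralizer_of_commute_degree_zero {S : Subring E}
    (hS : IsGradedDivisionSubring 𝒜 S) (hTS : Subring.center E ≤ S)
    (hΓ : gradeGroup 𝒜 S = gradeGroup 𝒜 (Subring.center E)) {x : E}
    (hx : ∀ a ∈ S, a ∈ 𝒜 0 → a * x = x * a) : x ∈ Subring.centralizer (S : Set E) := by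
  have hcent := (isGradedDivisionSubring_center (𝒜 := 𝒜))
  rw [← centralizer_homogeneous_eq hS.homogeneous, Subring.mem_centralizer_iff]
  rintro a ⟨haS, γ, ha⟩
  by_cases h0 : a = 0
  · simp [h0]
  obtain ⟨r, hrT, hr⟩ := hcent.mem_gradeGroup_iff.1 (hΓ ▸ mem_gradeGroup_of_mem haS ha h0)
  have h1 : a * ((r⁻¹ : Eˣ) : E) ∈ 𝒜 0 := by simpa using mul_inv_mem_sub ha hr
  have h3 := hx _ (mul_mem haS (hTS (hcent.inv_mem r ⟨_, hr⟩ hrT))) h1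
  have h4 : (r : E) * x = x * r := (Subring.mem_center_iff.1 hrT x).symm
  have h5 : a = a * ((r⁻¹ : Eˣ) : E) * r := by simp
  rw [h5, mul_assoc _ (r : E), h4, ← mul_assoc, h3, mul_assoc, mul_assoc]

/-- If `S` is a self-centralizing graded subring with `Γ_S = Γ_T`, then
`|Γ_E : Γ_T| ≤ [S₀ : T₀]`. -/
theorem card_reps_le_card {S : Subring E} (hS : IsGradedDivisionSubring 𝒜 S)
    (hC : Subring.centralizer (S : Set E) ≤ S) (hTS : Subring.center E ≤ S)
    (hΓ : gradeGroup 𝒜 S = gradeGroup 𝒜 (Subring.center E))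
    {ι κ : Type*} [Finite ι] [Finite κ]
    (b : Module.Basis ι (T₀ 𝒜) (degreeZeroPart (𝒜 := 𝒜) hTS))
    {y : κ → Eˣ} {g : κ → Γ} (hy : ∀ k, (y k : E) ∈ 𝒜 (g k))
    (hg : ∀ k k', g k - g k' ∈ gradeGroup 𝒜 (Subring.center E) → k = k') :
    Nat.card κ ≤ Nat.card ι := by
  classical
  let X := degreeZeroPart (𝒜 := 𝒜) hTS
  let v : κ → X → E₀ 𝒜 := fun k m => conjE₀ 𝒜 (y k) m
  have hC₀ : ∀ x : E, (∀ m : X, ((m : E₀ 𝒜) : E) * x = x * ((m : E₀ 𝒜) : E)) → x ∈ S :=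
    fun x hx => hC (mem_centralizer_of_commute_degree_zero hS hTS hΓ
      fun a haS ha => hx ⟨⟨a, ha⟩, haS⟩)
  have hv : LinearIndependent (E₀ 𝒜) v := by
    rw [LinearIndependent, ← LinearMap.ker_eq_bot]
    by_contra hne
    obtain ⟨w, hw, j, hj, hmin⟩ := exists_minimal_relation hne
    have hrel : ∀ w : κ →₀ E₀ 𝒜, w ∈ LinearMap.ker (Finsupp.linearCombination (E₀ 𝒜) v) ↔
        ∀ m : X, ∑ k ∈ w.support, w k * conjE₀ 𝒜 (y k) m = 0 := by
      intro w
      rw [LinearMap.mem_ker, Finsupp.linearCombination_apply, Finsupp.sum, funext_iff]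
      simp only [Finset.sum_apply, Pi.smul_apply, Pi.zero_apply, smul_eq_mul, v]
    -- Evaluating the relation at `m * m'` gives a relation in `m'` whose coefficient at `j` is
    -- `conjE₀ 𝒜 (y j) m`. By minimality it is that left multiple of `w`.
    have hcommw : ∀ (m : X) k, w k * conjE₀ 𝒜 (y k) m = conjE₀ 𝒜 (y j) m * w k := by
      intro m
      let w₁ : κ →₀ E₀ 𝒜 := Finsupp.onFinset w.support (fun k => w k * conjE₀ 𝒜 (y k) m)
        (fun k hk => Finsupp.mem_support_iff.2 (left_ne_zero_of_mul hk))
      have h1 : w₁ ∈ LinearMap.ker (Finsupp.linearCombination (E₀ 𝒜) v) := by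
        rw [hrel]
        intro m'
        have hmm : ((m : E₀ 𝒜) : E) * ((m' : E₀ 𝒜) : E) ∈ S := mul_mem m.2 m'.2
        have h2 := (hrel w).1 hw ⟨(m : E₀ 𝒜) * m', hmm⟩
        rw [Finset.sum_subset (Finsupp.support_onFinset_subset), ← h2]
        · refine Finset.sum_congr rfl fun i _ => ?_
          simp only [w₁, Finsupp.onFinset_apply, map_mul, mul_assoc]
        · intro k _ hk
          rw [Finsupp.notMem_support_iff.1 hk, zero_mul]
      have h2 := hmin (w₁ - conjE₀ 𝒜 (y j) m • w) (sub_mem h1 (Submodule.smul_mem _ _ hw)) ?_ ?_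
      · intro k
        exact sub_eq_zero.1 (DFunLike.congr_fun h2 k)
      · exact Finsupp.support_sub.trans
          (Finset.union_subset Finsupp.support_onFinset_subset Finsupp.support_smul)
      · rw [Finsupp.sub_apply, Finsupp.onFinset_apply, hj, Finsupp.smul_apply, hj]
        simp
    have hsupp : ∀ k, w k ≠ 0 → k = j := by
      intro k hk
      have hk' : (w k : E) ≠ 0 := fun h => hk (Subtype.ext h)
      -- By `hcommw` this element commutes with `S₀`, so it lies in `S`. Its degree `g k - g j` is
      -- then in `Γ_S = Γ_T`, which forces `k = j`.
      have h1 : ((y j)⁻¹ : Eˣ) * (w k : E) * y k ∈ S := by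
        apply hC₀
        intro m
        have h2 := congrArg Subtype.val (hcommw m k)
        simp only [Subring.coe_mul, coe_conjE₀] at h2
        have h3 : ((y j)⁻¹ : Eˣ) * ((y j : E) * m * ((y j)⁻¹ : Eˣ) * (w k : E)) * y k =
          ((y j)⁻¹ : Eˣ) * ((w k : E) * (y k * m * ((y k)⁻¹ : Eˣ))) * y k := by rw [h2]
        simpa [mul_assoc] using h3
      have h2 : ((y j)⁻¹ : Eˣ) * (w k : E) * y k ∈ 𝒜 (-g j + 0 + g k) :=
        SetLike.mul_mem_graded (SetLike.mul_mem_graded (inv_mem_neg (hy j)) (w k).2) (hy k)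
      have h3 := mem_gradeGroup_of_mem h1 h2 (by simpa using hk')
      rw [hΓ, add_zero, neg_add_eq_sub] at h3
      exact hg _ _ h3
    have h1 := (hrel w).1 hw ⟨1, one_mem S⟩
    rw [Finset.sum_eq_single j (fun k hk hkj => absurd (hsupp k (Finsupp.mem_support_iff.1 hk)) hkj)
      (fun hk => by rw [Finsupp.notMem_support_iff.1 hk, zero_mul]), hj] at h1
    simp at h1
  have := Fintype.ofFinite ι
  have := Fintype.ofFinite κ
  have hv' : LinearIndependent (E₀ 𝒜) (fun k i => conjE₀ 𝒜 (y k) (b i : E₀ 𝒜)) := by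
    -- Conjugations are `T₀`-linear, hence determined by their values on the basis `b`; `f` recovers
    -- the whole function from them.
    let f : (ι → E₀ 𝒜) →ₗ[E₀ 𝒜] (X → E₀ 𝒜) :=
      { toFun := fun x m => ∑ i, x i * algebraMap (T₀ 𝒜) (E₀ 𝒜) (b.repr m i)
        map_add' := fun x z => by
          ext m
          simp [add_mul, Finset.sum_add_distrib]
        map_smul' := fun c x => by
          ext m
          simp [Finset.mul_sum, mul_assoc] }
    refine LinearIndependent.of_comp f ?_
    convert hv using 1
    funext k m
    simp only [f, v, Function.comp_apply, LinearMap.coe_mk, AddHom.coe_mk]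
    conv_rhs => rw [← b.sum_repr m]
    rw [Submodule.coe_sum, map_sum]
    refine Finset.sum_congr rfl fun i _ => ?_
    rw [Submodule.coe_smul, map_smul, Algebra.smul_def, Algebra.commutes]
  have h := hv'.fintype_card_le_finrank
  rwa [Module.finrank_pi, ← Nat.card_eq_fintype_card, ← Nat.card_eq_fintype_card] at h

end Conjugation

/-! ### Semiramification -/

section Semiramified

variable {Γ E : Type*} [AddCommGroup Γ] [DecidableEq Γ] [Ring E]
  {𝒜 : Γ → AddSubgroup E} [GradedRing 𝒜] [IsGradedDivisionRing 𝒜]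
  [Module.Finite (Subring.center E) E]

attribute [local instance] divisionRingE₀ fieldT₀

/-- The `T`-basis of `E` consisting of products of a `T₀`-basis of `E₀` with representatives of
`Γ_E / Γ_T`. -/
noncomputable def mulBasis {ι κ : Type*} (b : Module.Basis ι (T₀ 𝒜) (E₀ 𝒜))
    {y : κ → Eˣ} {g : κ → Γ} (hy : ∀ k, (y k : E) ∈ 𝒜 (g k))
    (hg : ∀ k k', g k - g k' ∈ gradeGroup 𝒜 (Subring.center E) → k = k')
    (hg' : ∀ γ ∈ gradeGroup 𝒜 (⊤ : Subring E), ∃ k,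
      γ - g k ∈ gradeGroup 𝒜 (Subring.center E)) :
    Module.Basis (ι × κ) (Subring.center E) E :=
  Module.Basis.mk (linearIndependent_mul b.linearIndependent hy hg) (span_mul_eq_top b hy hg')

theorem mulBasis_apply {ι κ : Type*} (b : Module.Basis ι (T₀ 𝒜) (E₀ 𝒜))
    {y : κ → Eˣ} {g : κ → Γ} (hy : ∀ k, (y k : E) ∈ 𝒜 (g k))
    (hg : ∀ k k', g k - g k' ∈ gradeGroup 𝒜 (Subring.center E) → k = k')
    (hg' : ∀ γ ∈ gradeGroup 𝒜 (⊤ : Subring E), ∃ k,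
      γ - g k ∈ gradeGroup 𝒜 (Subring.center E)) (i : ι) (k : κ) :
    mulBasis b hy hg hg' (i, k) = b i * y k := by
  rw [mulBasis, Module.Basis.mk_apply]

variable (𝒜) in
theorem finrank_center : Module.finrank (Subring.center E) E =
    Module.finrank (T₀ 𝒜) (E₀ 𝒜) *
      (gradeGroup 𝒜 (Subring.center E)).relIndex (gradeGroup 𝒜 ⊤) := by
  have := IsGradedDivisionRing.nontrivial 𝒜
  have := IsGradedDivisionRing.isDomain 𝒜
  obtain ⟨g, y, -, hy, hg, hg'⟩ := (isGradedDivisionSubring_top (𝒜 := 𝒜)).exists_reps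
  let b := Module.Basis.ofVectorSpace (T₀ 𝒜) (E₀ 𝒜)
  rw [Module.finrank_eq_nat_card_basis (mulBasis b hy hg hg'), Module.finrank_eq_nat_card_basis b,
    Nat.card_prod]
  rfl

/-- A degree zero element of `L` outside `T` would be `T₀`-independent of `1`. Multiplying both by
representatives of `Γ_L / Γ_T` would give `2 |Γ_L : Γ_T|` independent elements, more than `[L : T]`.
-/
theorem mem_center_of_isTotallyRamified {L : Subring E} (hL : IsGradedDivisionSubring 𝒜 L)
    (hLT : IsTotallyRamifiedOverCenter 𝒜 L) {a : E} (haL : a ∈ L) (ha : a ∈ 𝒜 0) :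
    a ∈ Subring.center E := by
  have := IsGradedDivisionRing.nontrivial 𝒜
  have := IsGradedDivisionRing.isDomain 𝒜
  by_contra hcon
  obtain ⟨g, y, hyL, hy, hg, -⟩ := hL.exists_reps
  have hb : LinearIndependent (T₀ 𝒜) ![(1 : E₀ 𝒜), ⟨a, ha⟩] := by
    rw [LinearIndependent.pair_iff]
    intro s t hst
    have ht : t = 0 := by
      by_contra ht
      apply hcon
      have h1 : (⟨a, ha⟩ : E₀ 𝒜) = (-(t⁻¹ * s)) • (1 : E₀ 𝒜) := by
        rw [neg_smul, mul_smul, ← smul_neg, eq_inv_smul_iff₀ ht, eq_neg_iff_add_eq_zero, add_comm]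
        exact hst
      have h2 := congrArg Subtype.val h1
      rw [coe_smul_E₀, Subring.coe_one, mul_one] at h2
      rw [show a = _ from h2]
      exact (-(t⁻¹ * s)).2.1
    subst ht
    rw [zero_smul, add_zero] at hst
    exact ⟨(smul_eq_zero.1 hst).resolve_right one_ne_zero, rfl⟩
  have hli := linearIndependent_mul hb hy hg
  set P := Submodule.span (Subring.center E) (L : Set E) with hP
  have hmem : ∀ p : Fin 2 × _, ((![(1 : E₀ 𝒜), ⟨a, ha⟩] p.1 : E₀ 𝒜) : E) * y p.2 ∈ P := by
    rintro ⟨i, k⟩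
    refine Submodule.subset_span (mul_mem ?_ (hyL k))
    fin_cases i
    · exact one_mem L
    · exact haL
  have hliP : LinearIndependent (Subring.center E)
      (fun p : Fin 2 × _ => (⟨_, hmem p⟩ : P)) := LinearIndependent.of_comp P.subtype hli
  -- Infinite cardinals become `0` in `Nat.card` and `finrank`, so the contradiction needs both the
  -- index and the rank to be finite.
  have hfin := finite_reps hy hg
  have hrank : Module.rank (Subring.center E) P < Cardinal.aleph0 :=
    (Submodule.rank_le P).trans_lt (Module.rank_lt_aleph0 _ _)
  have hle := hliP.cardinal_lift_le_rank
  have h1 := Cardinal.toNat_le_toNat hle (by simpa using hrank)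
  rw [Cardinal.toNat_lift, Cardinal.toNat_lift] at h1
  change Nat.card _ ≤ Module.finrank _ _ at h1
  rw [hLT.finrank_eq, Nat.card_prod, Nat.card_fin] at h1
  change 2 * Nat.card (gradeGroup 𝒜 L ⧸ _) ≤ Nat.card (gradeGroup 𝒜 L ⧸ _) at h1
  have h2 : 0 < Nat.card (gradeGroup 𝒜 L ⧸
    (gradeGroup 𝒜 (Subring.center E)).addSubgroupOf (gradeGroup 𝒜 L)) := Nat.card_pos
  omega

/-- The chain `[E₀ : T₀] ≤ |Γ_L : Γ_T| ≤ |Γ_E : Γ_T| ≤ [M₀ : T₀] ≤ [E₀ : T₀]` closes up, so all its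
terms are equal. -/
theorem isSemiramified_of_maximal {M L : Subring E} (hM : Maximal (IsGradedSubfield 𝒜) M)
    (hMT : Subring.center E ≤ M) (hMΓ : gradeGroup 𝒜 M = gradeGroup 𝒜 (Subring.center E))
    (hL : Maximal (IsGradedSubfield 𝒜) L) (hLT : IsTotallyRamifiedOverCenter 𝒜 L) :
    IsSemiramified 𝒜 ∧ E₀ 𝒜 ≤ M ∧ gradeGroup 𝒜 ⊤ = gradeGroup 𝒜 L := by
  have := IsGradedDivisionRing.nontrivial 𝒜
  have := IsGradedDivisionRing.isDomain 𝒜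
  have := finite_E₀ 𝒜
  have hM' := hM.prop.isGradedDivisionSubring
  have hL' := hL.prop.isGradedDivisionSubring
  let X := degreeZeroPart (𝒜 := 𝒜) hMT
  have h1 : Module.finrank (T₀ 𝒜) (E₀ 𝒜) ≤
      (gradeGroup 𝒜 (Subring.center E)).relIndex (gradeGroup 𝒜 L) := by
    obtain ⟨g, y, hyL, hy, hg, hg'⟩ := hL'.exists_reps
    have := finite_reps hy hg
    let b := Module.finBasis (T₀ 𝒜) (E₀ 𝒜)
    rw [Module.finrank_eq_nat_card_basis b]
    exact card_le_card_reps hL' (centralizer_eq_of_maximal hL).le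
      (fun a haL ha => mem_center_of_isTotallyRamified hL' hLT haL ha) b.linearIndependent hyL hy hg'
  have h2 : (gradeGroup 𝒜 (Subring.center E)).relIndex (gradeGroup 𝒜 (⊤ : Subring E)) ≤
      Module.finrank (T₀ 𝒜) X := by
    obtain ⟨g, y, -, hy, hg, -⟩ := (isGradedDivisionSubring_top (𝒜 := 𝒜)).exists_reps
    have := finite_reps hy hg
    let b := Module.finBasis (T₀ 𝒜) X
    rw [Module.finrank_eq_nat_card_basis b]
    exact card_reps_le_card hM' (centralizer_eq_of_maximal hM).le hMT hMΓ b hy hg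
  have h3 : Module.finrank (T₀ 𝒜) X ≤ Module.finrank (T₀ 𝒜) (E₀ 𝒜) := Submodule.finrank_le X
  have h4 := AddSubgroup.relIndex_mul_relIndex (gradeGroup 𝒜 (Subring.center E)) (gradeGroup 𝒜 L)
    (gradeGroup 𝒜 ⊤) (gradeGroup_mono hLT.center_le) (gradeGroup_mono le_top)
  have hpos : 0 < Module.finrank (T₀ 𝒜) (E₀ 𝒜) := Module.finrank_pos
  have h5 : (gradeGroup 𝒜 L).relIndex (gradeGroup 𝒜 (⊤ : Subring E)) = 1 := by
    rcases Nat.lt_or_ge 1 ((gradeGroup 𝒜 L).relIndex (gradeGroup 𝒜 (⊤ : Subring E))) with h | h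
    · nlinarith
    · rcases Nat.le_one_iff_eq_zero_or_eq_one.1 h with h | h
      -- Index `0` stands for infinite index, which is excluded because `Γ_E / Γ_T` is finite.
      · rw [h, mul_zero] at h4
        obtain ⟨g, y, -, hy, hg, -⟩ := (isGradedDivisionSubring_top (𝒜 := 𝒜)).exists_reps
        have := finite_reps hy hg
        have h6 : 0 < Nat.card (gradeGroup 𝒜 (⊤ : Subring E) ⧸
          (gradeGroup 𝒜 (Subring.center E)).addSubgroupOf (gradeGroup 𝒜 ⊤)) := Nat.card_pos
        exact absurd h4 h6.ne
      · exact h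
  rw [h5, mul_one] at h4
  have hXtop : X = ⊤ := Submodule.eq_top_of_finrank_eq (by omega)
  have hE₀M : E₀ 𝒜 ≤ M := fun e he => by
    have h : (⟨e, he⟩ : E₀ 𝒜) ∈ X := by rw [hXtop]; trivial
    exact h
  have h6 : Module.finrank (T₀ 𝒜) (E₀ 𝒜) =
      (gradeGroup 𝒜 (Subring.center E)).relIndex (gradeGroup 𝒜 ⊤) := by omega
  refine ⟨⟨⟨⟨0, 1, zero_ne_one⟩, fun a b => Subtype.ext ?_, fun {a} ha => ?_⟩, h6, ?_⟩, hE₀M, ?_⟩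
  · exact hM.prop.comm a (hE₀M a.2) b (hE₀M b.2)
  · exact ⟨a⁻¹, mul_inv_cancel₀ ha⟩
  · rw [ind, finrank_center 𝒜, h6, Nat.sqrt_eq]
  · exact le_antisymm (AddSubgroup.relIndex_eq_one.1 h5) (gradeGroup_mono le_top)

end Semiramified

/-! ### Characteristic polynomials of left multiplications -/

section CharacteristicPolynomial

theorem charpoly_eq_pow_of_blocks {R V ι κ : Type*} [CommRing R] [AddCommGroup V] [Module R V]
    [Module.Free R V] [Module.Finite R V] [Fintype ι] [DecidableEq ι] [Fintype κ] [DecidableEq κ]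
    (b : Module.Basis (ι × κ) R V) (f : V →ₗ[R] V) (B : Matrix ι ι R)
    (h : ∀ i k, f (b (i, k)) = ∑ j, B j i • b (j, k)) :
    f.charpoly = B.charpoly ^ Fintype.card κ := by
  have h1 : LinearMap.toMatrix b b f = Matrix.blockDiagonal (fun _ : κ => B) := by
    ext ⟨i, k⟩ ⟨i', k'⟩
    rw [LinearMap.toMatrix_apply, h, map_sum, Finsupp.finsetSum_apply,
      Matrix.blockDiagonal_apply]
    simp only [map_smul, Module.Basis.repr_self, Finsupp.smul_apply, smul_eq_mul,
      Finsupp.single_apply, Prod.mk.injEq]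
    split_ifs with hk
    · subst hk
      simp
    · simp [Ne.symm hk]
  have h2 : (Matrix.blockDiagonal (fun _ : κ => B)).charmatrix =
      Matrix.blockDiagonal (fun _ : κ => B.charmatrix) := by
    ext1 ⟨i, k⟩ ⟨i', k'⟩
    simp only [Matrix.charmatrix_apply, Matrix.blockDiagonal_apply, Matrix.diagonal_apply,
      Prod.mk.injEq]
    split_ifs <;> simp_all
  rw [← f.charpoly_toMatrix b, h1, Matrix.charpoly, h2, Matrix.det_blockDiagonal, Finset.prod_const,
    Finset.card_univ, Matrix.charpoly]

/-- Left multiplication by `A` acts on each of the `N` columns separately, as `A`. -/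
theorem charpoly_lmul_matrix {F : Type*} [Field F] {N : ℕ} (A : Matrix (Fin N) (Fin N) F) :
    (Algebra.lmul F (Matrix (Fin N) (Fin N) F) A).charpoly = A.charpoly ^ N := by
  rw [charpoly_eq_pow_of_blocks (Matrix.stdBasis F (Fin N) (Fin N)) _ A, Fintype.card_fin]
  intro i k
  ext a c
  simp only [Matrix.stdBasis_eq_single, Algebra.coe_lmul_eq_mul, LinearMap.mul_apply',
    Matrix.sum_apply, Matrix.smul_apply, Matrix.mul_apply, Matrix.single_apply]
  by_cases hc : k = c <;> simp [hc, Finset.sum_ite_eq]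

/-- By unique factorization `p ^ n ∣ q ^ n` implies `p ∣ q`. This extracts the reduced
characteristic polynomial from its power. -/
theorem monic_eq_of_pow_eq {F : Type*} [Field F] {p q : Polynomial F} (hp : p.Monic)
    (hq : q.Monic) {n : ℕ} (hn : n ≠ 0) (h : p ^ n = q ^ n) : p = q :=
  Polynomial.eq_of_monic_of_associated hp hq (associated_of_dvd_dvd
    ((UniqueFactorizationMonoid.pow_dvd_pow_iff_dvd hn).1 h.dvd)
    ((UniqueFactorizationMonoid.pow_dvd_pow_iff_dvd hn).1 h.symm.dvd))

end CharacteristicPolynomial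

/-! ### The reduced norm on `E₀` -/

section ReducedNormE₀

variable {Γ E : Type*} [AddCommGroup Γ] [DecidableEq Γ] [Ring E]
  {𝒜 : Γ → AddSubgroup E} [GradedRing 𝒜] [IsGradedDivisionRing 𝒜]
  [Module.Finite (Subring.center E) E]

attribute [local instance] divisionRingE₀ fieldT₀

variable (𝒜) in
/-- The inclusion of `T₀` in `T`. -/
def T₀toCenter : T₀ 𝒜 →+* Subring.center E where
  toFun s := ⟨s, s.2.1⟩
  map_one' := rfl
  map_mul' _ _ := rfl
  map_zero' := rfl
  map_add' _ _ := rfl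

/-- In a semiramified graded division ring the reduced norm of an element of `E₀` is its norm
over `T₀`. -/
theorem reducedNorm_coe_E₀ [IsDomain E] (hE : IsSemiramified 𝒜) (a : E₀ 𝒜) :
    reducedNorm E (a : E) = algebraMap (Subring.center E) (SplitField E)
      (T₀toCenter 𝒜 (Algebra.norm (T₀ 𝒜) a)) := by
  classical
  have := IsGradedDivisionRing.nontrivial 𝒜
  have := finite_E₀ 𝒜
  let F := SplitField E
  let T := Subring.center E
  obtain ⟨g, y, -, hy, hg, hg'⟩ := (isGradedDivisionSubring_top (𝒜 := 𝒜)).exists_reps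
  have := finite_reps hy hg
  have := Fintype.ofFinite (gradeGroup 𝒜 (⊤ : Subring E) ⧸
    (gradeGroup 𝒜 (Subring.center E)).addSubgroupOf (gradeGroup 𝒜 ⊤))
  set n := Module.finrank (T₀ 𝒜) (E₀ 𝒜) with hn
  have hn0 : n ≠ 0 := (Module.finrank_pos (R := T₀ 𝒜) (M := E₀ 𝒜)).ne'
  let b := Module.finBasis (T₀ 𝒜) (E₀ 𝒜)
  let B := mulBasis b hy hg hg'
  have hfree : Module.Free T E := Module.Free.of_basis B
  have hcard : Fintype.card (gradeGroup 𝒜 (⊤ : Subring E) ⧸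
    (gradeGroup 𝒜 (Subring.center E)).addSubgroupOf (gradeGroup 𝒜 ⊤)) = n := by
    rw [← Nat.card_eq_fintype_card, hn, hE.finrank_eq]
    rfl
  set m := Algebra.leftMulMatrix b a with hm
  -- As a left `E₀`-module `E` is free on the `y k`, so multiplication by `a` consists of `n = |Γ_E
  -- : Γ_T|` copies of its action on `E₀`.
  have h1 : (Algebra.lmul T E (a : E)).charpoly = (m.map (T₀toCenter 𝒜)).charpoly ^ n := by
    rw [charpoly_eq_pow_of_blocks B _ (m.map (T₀toCenter 𝒜)), hcard]
    intro i k
    have h2 : a * b i = ∑ j, m j i • b j := by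
      rw [hm]
      simp only [Algebra.leftMulMatrix_eq_repr_mul]
      rw [b.sum_repr]
    simp only [B, mulBasis_apply, Algebra.coe_lmul_eq_mul, LinearMap.mul_apply']
    rw [← mul_assoc, ← Subring.coe_mul, h2, AddSubmonoidClass.coe_finsetSum, Finset.sum_mul]
    refine Finset.sum_congr rfl fun j _ => ?_
    rw [coe_smul_E₀, mul_assoc]
    rfl
  set A := splitting E ((1 : F) ⊗ₜ[T] (a : E)) with hA
  -- Extend scalars to `F` and transport along the splitting: the same polynomial is the
  -- characteristic polynomial of multiplication by `A`, which is `A.charpoly ^ n`.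
  have h2 : (Algebra.lmul F (Matrix (Fin (splitDegree E)) (Fin (splitDegree E)) F) A).charpoly =
      (Algebra.lmul T E (a : E)).charpoly.map (algebraMap T F) := by
    rw [← LinearMap.charpoly_baseChange, ← LinearEquiv.charpoly_conj (splitting E).toLinearEquiv]
    congr 1
    apply LinearMap.ext
    intro x
    rw [LinearEquiv.conj_apply_apply]
    obtain ⟨z, rfl⟩ := (splitting E).surjective x
    have h3 : (splitting E).toLinearEquiv.symm (splitting E z) = z :=
      (splitting E).symm_apply_apply z
    rw [h3]
    simp only [Algebra.coe_lmul_eq_mul, LinearMap.mul_apply', hA, ← map_mul]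
    change _ = splitting E _
    congr 1
    clear h3
    induction z using TensorProduct.induction_on with
    | zero => simp
    | add x y hx hy => rw [mul_add, map_add, hx, hy]
    | tmul f e => rw [LinearMap.baseChange_tmul, Algebra.TensorProduct.tmul_mul_tmul, one_mul,
        LinearMap.mul_apply']
  have hN : splitDegree E = n := by
    have h3 := (splitting E).toLinearEquiv.finrank_eq
    rw [Module.finrank_baseChange, Module.finrank_matrix, Module.finrank_self, mul_one,
      Fintype.card_fin, finrank_center 𝒜, ← hE.finrank_eq] at h3
    exact (Nat.mul_self_inj.1 h3).symm
  have h3 : A.charpoly = (m.map (T₀toCenter 𝒜)).charpoly.map (algebraMap T F) := by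
    refine monic_eq_of_pow_eq A.charpoly_monic ((Matrix.charpoly_monic _).map _) hn0 ?_
    rw [← Polynomial.map_pow, ← h1, ← h2, charpoly_lmul_matrix]
    exact congrArg (A.charpoly ^ ·) hN.symm
  have h4 : reducedNorm E (a : E) = A.det := rfl
  rw [h4, Matrix.det_eq_sign_charpoly_coeff, h3, Polynomial.coeff_map, Fintype.card_fin, hN,
    Algebra.norm_eq_matrix_det b, Matrix.det_eq_sign_charpoly_coeff, Matrix.charpoly_map,
    Polynomial.coeff_map]
  simp only [hm, hn, Fintype.card_fin, map_mul, map_pow, map_neg, map_one]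
  rfl

end ReducedNormE₀

/-! ### Symmetric elements and norms under `τ` -/

section GradedInvolution

variable {Γ E : Type*} [AddCommGroup Γ] [DecidableEq Γ] [Ring E] [StarRing E]
  {𝒜 : Γ → AddSubgroup E} [GradedRing 𝒜] [IsGradedInvolution 𝒜]

theorem star_mem_center {t : E} (ht : t ∈ Subring.center E) : star t ∈ Subring.center E := by
  rw [Subring.mem_center_iff] at *
  intro g
  simpa using (congrArg star (ht (star g))).symm

theorem decompose_star (x : E) (γ : Γ) :
    (DirectSum.decompose 𝒜 (star x) γ : E) = star (DirectSum.decompose 𝒜 x γ : E) := by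
  induction x using DirectSum.Decomposition.inductionOn 𝒜 with
  | zero => simp
  | @homogeneous i m =>
    have h := IsGradedInvolution.star_mem (𝒜 := 𝒜) i m m.2
    rcases eq_or_ne i γ with rfl | hne
    · rw [DirectSum.decompose_of_mem_same 𝒜 h, DirectSum.decompose_of_mem_same 𝒜 m.2]
    · rw [DirectSum.decompose_of_mem_ne 𝒜 h hne, DirectSum.decompose_of_mem_ne 𝒜 m.2 hne, star_zero]
  | add x y hx hy => simp [hx, hy]

theorem isGradedDivisionSubring_fixedCenter :
    IsGradedDivisionSubring 𝒜 (fixedCenter E) where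
  homogeneous i m hm := ⟨isGradedDivisionSubring_center.homogeneous i hm.1, by
    rw [← decompose_star, hm.2]⟩
  inv_mem u hu hm := by
    refine ⟨isGradedDivisionSubring_center.inv_mem u hu hm.1, ?_⟩
    have h : star u = u := Units.ext hm.2
    rw [← Units.coe_star, star_inv, h]

variable [IsGradedDivisionRing 𝒜]

/-- If `T` is unramified over `R`, then a unitary involution is nontrivial on `T₀`. -/
theorem exists_star_ne_of_gradeGroup_eq (hunitary : ∃ t ∈ Subring.center E, star t ≠ t)
    (hTR : gradeGroup 𝒜 (Subring.center E) = gradeGroup 𝒜 (fixedCenter E)) :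
    ∃ t ∈ T₀ 𝒜, star t ≠ t := by
  classical
  by_contra! hcon
  obtain ⟨t, ht, hne⟩ := hunitary
  apply hne
  rw [← DirectSum.sum_support_decompose 𝒜 t, star_sum]
  refine Finset.sum_congr rfl fun γ _ => ?_
  have htγ := (isGradedDivisionSubring_center (𝒜 := 𝒜)).homogeneous γ ht
  by_cases h0 : (DirectSum.decompose 𝒜 t γ : E) = 0
  · rw [h0, star_zero]
  -- Since `Γ_T = Γ_R`, the component of `t` is an element of `T₀` times a unit of `R`; if `τ` were
  -- trivial on `T₀`, both factors would be fixed.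
  obtain ⟨r, hrR, hr⟩ := isGradedDivisionSubring_fixedCenter.mem_gradeGroup_iff.1
    (hTR ▸ mem_gradeGroup_of_mem htγ (SetLike.coe_mem _) h0)
  have hs : (DirectSum.decompose 𝒜 t γ : E) * ((r⁻¹ : Eˣ) : E) ∈ T₀ 𝒜 :=
    ⟨mul_mem htγ (isGradedDivisionSubring_center.inv_mem r ⟨_, hr⟩ hrR.1), by
      have h := mul_inv_mem_sub (SetLike.coe_mem (DirectSum.decompose 𝒜 t γ)) hr
      rwa [sub_self] at h⟩
  have h1 := hcon _ hs
  have h2 : (DirectSum.decompose 𝒜 t γ : E) =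
      (DirectSum.decompose 𝒜 t γ : E) * ((r⁻¹ : Eˣ) : E) * r := by simp
  rw [h2, star_mul, h1, hrR.2]
  exact (Subring.mem_center_iff.1 hrR.1 _).symm

/-- A `τ`-stable graded subfield contains symmetric elements in every degree of its grade group,
if `τ` is nontrivial on `T₀`. -/
theorem exists_symmetric_unit {S : Subring E} (hS : IsGradedDivisionSubring 𝒜 S)
    (hTS : Subring.center E ≤ S) (hstar : ∀ x ∈ S, star x ∈ S)
    (ht : ∃ t ∈ T₀ 𝒜, star t ≠ t) {γ : Γ} (hγ : γ ∈ gradeGroup 𝒜 S) :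
    ∃ z : Eˣ, (z : E) ∈ S ∧ (z : E) ∈ 𝒜 γ ∧ star z = z := by
  obtain ⟨u, huS, hu⟩ := hS.mem_gradeGroup_iff.1 hγ
  have hu' := IsGradedInvolution.star_mem (𝒜 := 𝒜) γ u hu
  -- The sum `u + τ(u)` is symmetric. If it vanishes, `u` is skew, and multiplying by the nonzero
  -- skew central element `t - τ(t)` gives a symmetric element.
  by_cases h0 : (u : E) + star (u : E) = 0
  · obtain ⟨t, htT, hne⟩ := ht
    have htT' : t - star t ∈ T₀ 𝒜 := sub_mem htT
      ⟨star_mem_center htT.1, IsGradedInvolution.star_mem (𝒜 := 𝒜) 0 t htT.2⟩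
    have hne' : (t - star t) * (u : E) ≠ 0 := by
      rw [Ne, Units.mul_left_eq_zero]
      exact fun h => hne (sub_eq_zero.1 h).symm
    have hdeg : (t - star t) * (u : E) ∈ 𝒜 γ := by
      have h := SetLike.mul_mem_graded (show t - star t ∈ 𝒜 0 from htT'.2) hu
      rwa [zero_add] at h
    obtain ⟨z, hz⟩ := exists_unit 𝒜 hdeg hne'
    refine ⟨z, hz ▸ mul_mem (hTS htT'.1) huS, hz ▸ hdeg, Units.ext ?_⟩
    rw [Units.coe_star, hz, star_mul, star_sub, star_star, eq_neg_of_add_eq_zero_right h0,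
      ← Subring.mem_center_iff.1 htT'.1 u]
    noncomm_ring
  · obtain ⟨z, hz⟩ := exists_unit 𝒜 (add_mem hu hu') h0
    refine ⟨z, hz ▸ add_mem huS (hstar _ huS), hz ▸ add_mem hu hu', Units.ext ?_⟩
    rw [Units.coe_star, hz, star_add, star_star, add_comm]

/-- The restriction of the involution to `T₀`. -/
def starT₀ : T₀ 𝒜 ≃+* T₀ 𝒜 where
  toFun t := ⟨star (t : E), star_mem_center t.2.1, IsGradedInvolution.star_mem (𝒜 := 𝒜) 0 _ t.2.2⟩
  invFun t := ⟨star (t : E), star_mem_center t.2.1, IsGradedInvolution.star_mem (𝒜 := 𝒜) 0 _ t.2.2⟩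
  left_inv t := Subtype.ext (star_star _)
  right_inv t := Subtype.ext (star_star _)
  map_mul' a b := Subtype.ext (by
    simpa using (Subring.mem_center_iff.1 (star_mem_center a.2.1) (star (b : E))))
  map_add' a b := Subtype.ext (star_add _ _)

/-- When `E₀` is commutative, `τ̄` is a ring automorphism of `E₀` that restricts to one of `T₀`, and
norms are transported along such pairs. -/
theorem norm_τ₀ (hcomm : ∀ a b : E₀ 𝒜, a * b = b * a) (a : E₀ 𝒜) :
    (Algebra.norm (T₀ 𝒜) (τ₀ 𝒜 a) : E) = star (Algebra.norm (T₀ 𝒜) a : E) := by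
  let e : E₀ 𝒜 ≃+* E₀ 𝒜 :=
    { toFun := τ₀ 𝒜
      invFun := τ₀ 𝒜
      left_inv := fun a => Subtype.ext (star_star _)
      right_inv := fun a => Subtype.ext (star_star _)
      map_mul' := fun a b => by
        rw [hcomm a b]
        exact Subtype.ext (star_mul _ _)
      map_add' := fun a b => Subtype.ext (star_add _ _) }
  have h := Algebra.norm_eq_of_equiv_equiv (starT₀ (𝒜 := 𝒜)) e (RingHom.ext fun t => rfl) (τ₀ 𝒜 a)
  have h1 : e (τ₀ 𝒜 a) = a := Subtype.ext (star_star _)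
  rw [h1] at h
  exact congrArg Subtype.val h

variable [Module.Finite (Subring.center E) E]

variable (𝒜) in
theorem symSubgroup_le_nrdSubgroup : symSubgroup E ≤ nrdSubgroup 𝒜 := by
  have := IsGradedDivisionRing.isDomain 𝒜
  refine (Subgroup.closure_le _).2 fun a ha => ?_
  change reducedNorm E ((a * (star a)⁻¹ : Eˣ) : E) = 1
  rw [Set.mem_ofPred_eq] at ha
  rw [ha, mul_inv_cancel, Units.val_one, map_one]

variable (𝒜) in
/-- The inclusion of `E₀^*` in `E^*`. -/
def unitsE₀ : (E₀ 𝒜)ˣ →* Eˣ := Units.map (E₀ 𝒜).subtype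

theorem coe_unitsE₀ (a : (E₀ 𝒜)ˣ) : (unitsE₀ 𝒜 a : E) = (a : E₀ 𝒜) := rfl

/-- The condition `Nrd(a τ(a)⁻¹) = 1` means `Nrd(a) = Nrd(τ(a))`. On `E₀` this reads `N(a) =
τ(N(a))`, because `T` embeds in the splitting field. -/
theorem unitsE₀_mem_nrdSubgroup_iff (hE : IsSemiramified 𝒜) (a : (E₀ 𝒜)ˣ) :
    unitsE₀ 𝒜 a ∈ nrdSubgroup 𝒜 ↔ a ∈ normSubgroup 𝒜 := by
  have := IsGradedDivisionRing.isDomain 𝒜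
  have h1 : unitsE₀ 𝒜 a ∈ nrdSubgroup 𝒜 ↔
      reducedNorm E (unitsE₀ 𝒜 a : E) = reducedNorm E ((star (unitsE₀ 𝒜 a) : Eˣ) : E) := by
    change reducedNorm E ((unitsE₀ 𝒜 a * (star (unitsE₀ 𝒜 a))⁻¹ : Eˣ) : E) = 1 ↔ _
    have h2 : reducedNorm E ((star (unitsE₀ 𝒜 a) : Eˣ) : E) *
        reducedNorm E (((star (unitsE₀ 𝒜 a))⁻¹ : Eˣ) : E) = 1 := by
      rw [← map_mul, Units.mul_inv, map_one]
    rw [Units.val_mul, map_mul]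
    constructor
    · intro h
      exact mul_right_cancel₀ (right_ne_zero_of_mul_eq_one h2) (h.trans h2.symm)
    · intro h
      rw [h, h2]
  have hinj : Function.Injective (algebraMap (Subring.center E) (SplitField E)) := by
    rw [IsScalarTower.algebraMap_eq _ (FractionRing (Subring.center E)), RingHom.coe_comp]
    exact (algebraMap (FractionRing (Subring.center E)) (SplitField E)).injective.comp
      (IsFractionRing.injective _ _)
  have h3 : ((star (unitsE₀ 𝒜 a) : Eˣ) : E) = (τ₀ 𝒜 (a : E₀ 𝒜) : E) := rfl
  rw [h1, h3, coe_unitsE₀, reducedNorm_coe_E₀ hE, reducedNorm_coe_E₀ hE, hinj.eq_iff,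
    ← Subtype.coe_inj]
  change (Algebra.norm (T₀ 𝒜) (a : E₀ 𝒜) : E) = (Algebra.norm (T₀ 𝒜) (τ₀ 𝒜 (a : E₀ 𝒜)) : E) ↔ _
  rw [norm_τ₀ hE.isField.mul_comm]
  exact ⟨fun h => ⟨(Algebra.norm (T₀ 𝒜) (a : E₀ 𝒜)).2.1, h.symm⟩, fun h => h.2.symm⟩

end GradedInvolution

/-! ### The Galois group of `E₀` over `T₀` -/

section Galois

variable {Γ E : Type*} [AddCommGroup Γ] [DecidableEq Γ] [Ring E]
  {𝒜 : Γ → AddSubgroup E} [GradedRing 𝒜] [IsGradedDivisionRing 𝒜]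
  [Module.Finite (Subring.center E) E]

attribute [local instance] fieldT₀

/-- If `E` is semiramified and `M` is a self-centralizing graded subring with `M₀ = E₀` and
`Γ_M = Γ_T`, then conjugation by representatives of `Γ_E / Γ_T` gives the whole Galois group of
`E₀` over `T₀`. -/
theorem exists_conjE₀_eq (hE : IsSemiramified 𝒜) {M : Subring E}
    (hM : IsGradedDivisionSubring 𝒜 M) (hC : Subring.centralizer (M : Set E) ≤ M)
    (hTM : Subring.center E ≤ M) (hMΓ : gradeGroup 𝒜 M = gradeGroup 𝒜 (Subring.center E))
    (Z : Set Eˣ) (hZ : ∀ γ ∈ gradeGroup 𝒜 (⊤ : Subring E), ∃ z ∈ Z, (z : E) ∈ 𝒜 γ)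
    (h : E₀ 𝒜 ≃ₐ[T₀ 𝒜] E₀ 𝒜) : ∃ z ∈ Z, conjE₀ 𝒜 z = h := by
  classical
  have := finite_E₀ 𝒜
  let _ : Field (E₀ 𝒜) := { divisionRingE₀ 𝒜 with mul_comm := hE.isField.mul_comm }
  obtain ⟨g, y, -, hy, hg, -⟩ := (isGradedDivisionSubring_top (𝒜 := 𝒜)).exists_reps
  have := finite_reps hy hg
  choose z hzZ hz using fun q => hZ (g q) (mem_gradeGroup_of_mem trivial (hy q)
    (have := IsGradedDivisionRing.nontrivial 𝒜; (y q).ne_zero))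
  -- If two representatives act alike on `E₀`, their quotient centralizes `M`, hence lies in `M` and
  -- has degree in `Γ_M = Γ_T`. Surjectivity then follows by counting: `|Gal(E₀/T₀)| ≤ [E₀ : T₀] =
  -- |Γ_E : Γ_T|`.
  have hinj : Function.Injective fun q => conjE₀ 𝒜 (z q) := by
    intro q q' hqq
    have h1 : conjE₀ 𝒜 (z q * (z q')⁻¹) = 1 := by
      rw [map_mul, map_inv, mul_inv_eq_one]
      exact hqq
    have h2 : ((z q * (z q')⁻¹ : Eˣ) : E) ∈ M := hC <|
      mem_centralizer_of_commute_degree_zero hM hTM hMΓ fun a _ ha =>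
        (conjE₀_eq_self_iff.1 (DFunLike.congr_fun h1 (⟨a, ha⟩ : E₀ 𝒜))).symm
    have h3 := mem_gradeGroup_of_mem h2 (mul_inv_mem_sub (hz q) (hz q'))
      (have := IsGradedDivisionRing.nontrivial 𝒜; Units.ne_zero _)
    rw [hMΓ] at h3
    exact hg _ _ h3
  have hcard : Nat.card (E₀ 𝒜 ≃ₐ[T₀ 𝒜] E₀ 𝒜) ≤ Nat.card (gradeGroup 𝒜 (⊤ : Subring E) ⧸
      (gradeGroup 𝒜 (Subring.center E)).addSubgroupOf (gradeGroup 𝒜 ⊤)) := by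
    have h1 := AlgEquiv.card_le (F := T₀ 𝒜) (K := E₀ 𝒜)
    rw [← Nat.card_eq_fintype_card] at h1
    exact h1.trans hE.finrank_eq.le
  obtain ⟨q, hq⟩ := (hinj.bijective_of_nat_card_le hcard).2 h
  exact ⟨z q, hzZ q, hq⟩

end Galois

/-! ### Symmetric products inside `E₀^*` and the group `SK₁` -/

section WhiteheadGroup

variable {Γ E : Type*} [AddCommGroup Γ] [DecidableEq Γ] [Ring E] [StarRing E]
  {𝒜 : Γ → AddSubgroup E} [GradedRing 𝒜] [IsGradedInvolution 𝒜] [IsGradedDivisionRing 𝒜]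

theorem mem_prodFixedUnits {h : E₀ 𝒜 ≃ₐ[T₀ 𝒜] E₀ 𝒜} {a : (E₀ 𝒜)ˣ}
    (ha : h (τ₀ 𝒜 a) = a) : a ∈ prodFixedUnits 𝒜 :=
  (le_iSup (fixedUnits 𝒜) h) (Subgroup.subset_closure ha)

theorem prodFixedUnits_le {H : Subgroup (E₀ 𝒜)ˣ}
    (hH : ∀ (h : E₀ 𝒜 ≃ₐ[T₀ 𝒜] E₀ 𝒜) (a : (E₀ 𝒜)ˣ), h (τ₀ 𝒜 a) = a → a ∈ H) :
    prodFixedUnits 𝒜 ≤ H :=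
  iSup_le fun h => (Subgroup.closure_le _).2 fun a ha => hH h a ha

theorem coe_τ₀ (a : E₀ 𝒜) : (τ₀ 𝒜 a : E) = star (a : E) := rfl

theorem star_coe_of_star_eq {z : Eˣ} (hz : star z = z) : star (z : E) = z :=
  congrArg Units.val hz

/-- `a z` is symmetric if and only if `a` is fixed by `τ̄` followed by conjugation by the symmetric
unit `z`. -/
theorem star_mul_eq_iff {z : Eˣ} (hz : star z = z) (a : (E₀ 𝒜)ˣ) :
    star (unitsE₀ 𝒜 a * z) = unitsE₀ 𝒜 a * z ↔ conjE₀ 𝒜 z (τ₀ 𝒜 a) = a := by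
  rw [← Subtype.coe_inj, coe_conjE₀, coe_τ₀, Units.mul_inv_eq_iff_eq_mul, ← Units.val_inj,
    star_mul, hz]
  rfl

/-- For symmetric `z`, with `c` the conjugation by `z`, one has `τ̄ c = c⁻¹ τ̄`. Hence if `h τ̄`
fixes `a`, then `(c h c) τ̄` fixes `c(a)`. -/
theorem map_conjE₀_mem_prodFixedUnits {z : Eˣ} (hz : star z = z) {a : (E₀ 𝒜)ˣ}
    (ha : a ∈ prodFixedUnits 𝒜) :
    Units.map (conjE₀ 𝒜 z : E₀ 𝒜 →* E₀ 𝒜) a ∈ prodFixedUnits 𝒜 := by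
  suffices h : prodFixedUnits 𝒜 ≤
      (prodFixedUnits 𝒜).comap (Units.map (conjE₀ 𝒜 z : E₀ 𝒜 →* E₀ 𝒜)) from h ha
  refine prodFixedUnits_le fun h a ha => mem_prodFixedUnits (h := conjE₀ 𝒜 z * h * conjE₀ 𝒜 z) ?_
  have hz' := star_coe_of_star_eq hz
  have hzi := star_coe_of_star_eq (z := z⁻¹) (by rw [star_inv, hz])
  have h1 : conjE₀ 𝒜 z (τ₀ 𝒜 (conjE₀ 𝒜 z a)) = τ₀ 𝒜 a := Subtype.ext (by
    simp [coe_conjE₀, coe_τ₀, hz', hzi, mul_assoc])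
  change conjE₀ 𝒜 z (h (conjE₀ 𝒜 z (τ₀ 𝒜 (conjE₀ 𝒜 z a)))) = conjE₀ 𝒜 z a
  rw [h1, ha]

/-- If `h` is conjugation by the symmetric `z` and `h τ̄` fixes `a`, then `a = (az) z⁻¹` is a
product of symmetric units. -/
theorem prodFixedUnits_le_comap (Z : Set Eˣ) (hZ : ∀ z ∈ Z, star z = z)
    (hconj : ∀ h : E₀ 𝒜 ≃ₐ[T₀ 𝒜] E₀ 𝒜, ∃ z ∈ Z, conjE₀ 𝒜 z = h) :
    prodFixedUnits 𝒜 ≤ (symSubgroup E).comap (unitsE₀ 𝒜) := by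
  refine prodFixedUnits_le fun h a ha => ?_
  obtain ⟨z, hzZ, rfl⟩ := hconj h
  rw [Subgroup.mem_comap, ← mul_inv_cancel_right (unitsE₀ 𝒜 a) z]
  exact mul_mem (Subgroup.subset_closure ((star_mul_eq_iff (hZ z hzZ) a).2 ha))
    (inv_mem (Subgroup.subset_closure (hZ z hzZ)))

theorem comap_symSubgroup_le (Z : Subgroup Eˣ) (hZ : ∀ z ∈ Z, star z = z)
    (hdecomp : ∀ u : Eˣ, ∃ a : (E₀ 𝒜)ˣ, ∃ z ∈ Z, u = unitsE₀ 𝒜 a * z) :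
    (symSubgroup E).comap (unitsE₀ 𝒜) ≤ prodFixedUnits 𝒜 := by
  have hconj : ∀ (z : Eˣ) (a : (E₀ 𝒜)ˣ), z * unitsE₀ 𝒜 a =
      unitsE₀ 𝒜 (Units.map (conjE₀ 𝒜 z : E₀ 𝒜 →* E₀ 𝒜) a) * z := by
    intro z a
    rw [← mul_inv_eq_iff_eq_mul]
    exact Units.ext rfl
  -- Conjugation by `Z` preserves `prodFixedUnits 𝒜`, so its product with `Z` is a group. It
  -- contains every symmetric unit, since each has the form `az`.
  let Q : Subgroup Eˣ :=
    { carrier := {u | ∃ p ∈ prodFixedUnits 𝒜, ∃ z ∈ Z, u = unitsE₀ 𝒜 p * z}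
      one_mem' := ⟨1, one_mem _, 1, one_mem _, by simp⟩
      mul_mem' := by
        rintro _ _ ⟨p, hp, z, hz, rfl⟩ ⟨p', hp', z', hz', rfl⟩
        refine ⟨_, mul_mem hp (map_conjE₀_mem_prodFixedUnits (hZ z hz) hp'), z * z',
          mul_mem hz hz', ?_⟩
        rw [map_mul, mul_assoc, ← mul_assoc z, hconj, mul_assoc, mul_assoc]
      inv_mem' := by
        rintro _ ⟨p, hp, z, hz, rfl⟩
        refine ⟨_, map_conjE₀_mem_prodFixedUnits (hZ _ (inv_mem hz)) (inv_mem hp), z⁻¹,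
          inv_mem hz, ?_⟩
        rw [mul_inv_rev, ← map_inv, hconj] }
  have hQ : symSubgroup E ≤ Q := by
    refine (Subgroup.closure_le _).2 fun u hu => ?_
    obtain ⟨a, z, hz, rfl⟩ := hdecomp u
    exact ⟨a, mem_prodFixedUnits ((star_mul_eq_iff (hZ z hz) a).1 hu), z, hz, rfl⟩
  intro a ha
  obtain ⟨p, hp, z, hz, h⟩ := hQ ha
  have h1 : z = unitsE₀ 𝒜 (p⁻¹ * a) := by
    rw [map_mul, map_inv, h, inv_mul_cancel_left]
  have h2 : p⁻¹ * a ∈ prodFixedUnits 𝒜 := by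
    -- The leftover factor `z` lies in both `Z` and `E₀^*`, so it is fixed by `τ̄` itself.
    refine mem_prodFixedUnits (h := 1) (Subtype.ext ?_)
    have h3 := star_coe_of_star_eq (hZ z hz)
    rw [h1] at h3
    exact h3
  simpa using mul_mem hp h2

variable [Module.Finite (Subring.center E) E]

/-- The factor from `Z` dies in `SK₁`, so `E₀^* ∩ Σ'_τ(E)` maps onto it; the kernel is `E₀^* ∩
Σ_τ(E)`, identified by `hP`. -/
theorem nonempty_SK₁_mulEquiv (hE : IsSemiramified 𝒜) (Z : Subgroup Eˣ)
    (hZ : ∀ z ∈ Z, star z = z)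
    (hdecomp : ∀ u : Eˣ, ∃ a : (E₀ 𝒜)ˣ, ∃ z ∈ Z, u = unitsE₀ 𝒜 a * z)
    (hP : (symSubgroup E).comap (unitsE₀ 𝒜) = prodFixedUnits 𝒜)
    [((prodFixedUnits 𝒜).subgroupOf (normSubgroup 𝒜)).Normal] :
    Nonempty (SK₁ 𝒜 ≃* normSubgroup 𝒜 ⧸ (prodFixedUnits 𝒜).subgroupOf (normSubgroup 𝒜)) := by
  let ι : normSubgroup 𝒜 →* nrdSubgroup 𝒜 :=
    ((unitsE₀ 𝒜).comp (normSubgroup 𝒜).subtype).codRestrict (nrdSubgroup 𝒜)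
      fun a => (unitsE₀_mem_nrdSubgroup_iff hE a).2 a.2
  let φ : normSubgroup 𝒜 →* SK₁ 𝒜 :=
    (QuotientGroup.mk' ((symSubgroup E).subgroupOf (nrdSubgroup 𝒜))).comp ι
  have hφ : Function.Surjective φ := by
    intro x
    obtain ⟨⟨u, hu⟩, rfl⟩ := QuotientGroup.mk_surjective x
    obtain ⟨a, z, hz, rfl⟩ := hdecomp u
    have hzs : z ∈ symSubgroup E := Subgroup.subset_closure (hZ z hz)
    have ha : unitsE₀ 𝒜 a ∈ nrdSubgroup 𝒜 := by
      simpa using mul_mem hu (inv_mem (symSubgroup_le_nrdSubgroup 𝒜 hzs))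
    refine ⟨⟨a, (unitsE₀_mem_nrdSubgroup_iff hE a).1 ha⟩, ?_⟩
    refine QuotientGroup.eq.2 ?_
    rw [Subgroup.mem_subgroupOf]
    change (unitsE₀ 𝒜 a)⁻¹ * (unitsE₀ 𝒜 a * z) ∈ _
    rwa [inv_mul_cancel_left]
  have hker : φ.ker = (prodFixedUnits 𝒜).subgroupOf (normSubgroup 𝒜) := by
    ext a
    rw [MonoidHom.mem_ker, Subgroup.mem_subgroupOf, ← hP, Subgroup.mem_comap]
    exact QuotientGroup.eq_one_iff (ι a)
  exact ⟨(QuotientGroup.quotientKerEquivOfSurjective φ hφ).symm.trans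
    (QuotientGroup.quotientMulEquivOfEq hker)⟩

/-- If the subgroup `Z` of `E^*` meets every degree in `Γ_E`, then `E^* = E₀^* Z`. -/
theorem exists_eq_unitsE₀_mul {Z : Subgroup Eˣ}
    (hZ : ∀ γ ∈ gradeGroup 𝒜 (⊤ : Subring E), ∃ z ∈ Z, (z : E) ∈ 𝒜 γ) (u : Eˣ) :
    ∃ a : (E₀ 𝒜)ˣ, ∃ z ∈ Z, u = unitsE₀ 𝒜 a * z := by
  have := IsGradedDivisionRing.nontrivial 𝒜
  obtain ⟨γ, hγ⟩ := isHomogeneousElem_unit 𝒜 u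
  obtain ⟨z, hzZ, hz⟩ := hZ γ (mem_gradeGroup_of_mem trivial hγ u.ne_zero)
  have h1 : ((u * z⁻¹ : Eˣ) : E) ∈ 𝒜 0 := by
    simpa using mul_inv_mem_sub hγ hz
  have h2 : (((u * z⁻¹)⁻¹ : Eˣ) : E) ∈ 𝒜 0 := by
    have := inv_mem_neg h1
    rwa [neg_zero] at this
  refine ⟨⟨⟨_, h1⟩, ⟨_, h2⟩, Subtype.ext (Units.mul_inv (u * z⁻¹)),
    Subtype.ext (Units.inv_mul (u * z⁻¹))⟩,
    z, hzZ, ?_⟩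
  rw [← mul_inv_eq_iff_eq_mul]
  exact Units.ext rfl

end WhiteheadGroup
end UnitarySK

theorem corollary4p9 {Γ : Type*} {E : Type*} [AddCommGroup Γ] [DecidableEq Γ]
    [Ring E] (𝒜 : Γ → AddSubgroup E) [GradedRing 𝒜] [UnitarySK.IsGradedDivisionRing 𝒜]
    [Module.Finite (Subring.center E) E]
    [StarRing E] [UnitarySK.IsGradedInvolution 𝒜]
    -- the involution is unitary
    (hunitary : ∃ t ∈ Subring.center E, star t ≠ t)
    -- the centre `T` is unramified over `R = T^τ`
    (hTR : UnitarySK.gradeGroup 𝒜 (Subring.center E) =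
      UnitarySK.gradeGroup 𝒜 (UnitarySK.fixedCenter E))
    (M : Subring E) (hM : Maximal (UnitarySK.IsGradedSubfield 𝒜) M)
    (hMT : UnitarySK.IsUnramifiedOverCenter 𝒜 M)
    (L : Subring E) (hL : Maximal (UnitarySK.IsGradedSubfield 𝒜) L)
    (hLT : UnitarySK.IsTotallyRamifiedOverCenter 𝒜 L)
    (hLτ : ∀ x ∈ L, star x ∈ L) :
    UnitarySK.IsSemiramified 𝒜 ∧
    UnitarySK.E₀ 𝒜 = UnitarySK.E₀ 𝒜 ⊓ M ∧
    UnitarySK.gradeGroup 𝒜 ⊤ = UnitarySK.gradeGroup 𝒜 L ∧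
    UnitarySK.prodFixedUnits 𝒜 ≤ UnitarySK.normSubgroup 𝒜 ∧
    ∃ _ : ((UnitarySK.prodFixedUnits 𝒜).subgroupOf (UnitarySK.normSubgroup 𝒜)).Normal,
      Nonempty (UnitarySK.SK₁ 𝒜 ≃*
        UnitarySK.normSubgroup 𝒜 ⧸
          (UnitarySK.prodFixedUnits 𝒜).subgroupOf (UnitarySK.normSubgroup 𝒜)) := by
  have := UnitarySK.IsGradedDivisionRing.nontrivial 𝒜
  obtain ⟨hE, hEM, hΓ⟩ :=
    UnitarySK.isSemiramified_of_maximal hM hMT.center_le hMT.gradeGroup_eq hL hLT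
  have hL' := hL.prop.isGradedDivisionSubring
  -- Closure under products uses the commutativity of `L`: a product of commuting symmetric elements
  -- is symmetric.
  let Z : Subgroup Eˣ :=
    { carrier := {z | (z : E) ∈ L ∧ star z = z}
      one_mem' := ⟨one_mem L, star_one _⟩
      mul_mem' := fun {a b} ha hb => ⟨mul_mem ha.1 hb.1, by
        rw [star_mul, ha.2, hb.2]
        exact Units.ext (hL.prop.comm _ hb.1 _ ha.1)⟩
      inv_mem' := fun {a} ha => ⟨hL'.inv_mem a (UnitarySK.isHomogeneousElem_unit 𝒜 a) ha.1, by
        rw [star_inv, ha.2]⟩ }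
  have hZ : ∀ z ∈ Z, star z = z := fun z hz => hz.2
  have hZΓ : ∀ γ ∈ UnitarySK.gradeGroup 𝒜 (⊤ : Subring E), ∃ z ∈ Z, (z : E) ∈ 𝒜 γ := by
    intro γ hγ
    obtain ⟨z, hzL, hz, hs⟩ := UnitarySK.exists_symmetric_unit hL' hLT.center_le hLτ
      (UnitarySK.exists_star_ne_of_gradeGroup_eq hunitary hTR) (hΓ ▸ hγ)
    exact ⟨z, ⟨hzL, hs⟩, hz⟩
  have hdecomp := UnitarySK.exists_eq_unitsE₀_mul hZΓ
  have hconj := UnitarySK.exists_conjE₀_eq hE hM.prop.isGradedDivisionSubring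
    (UnitarySK.centralizer_eq_of_maximal hM).le hMT.center_le hMT.gradeGroup_eq Z hZΓ
  have hP := le_antisymm (UnitarySK.comap_symSubgroup_le Z hZ hdecomp)
    (UnitarySK.prodFixedUnits_le_comap Z hZ hconj)
  have hnormal : ((UnitarySK.prodFixedUnits 𝒜).subgroupOf
      (UnitarySK.normSubgroup 𝒜)).Normal := by
    refine ⟨fun n hn g => ?_⟩
    have h : g * n * g⁻¹ = n := by
      rw [mul_inv_eq_iff_eq_mul]
      exact Subtype.ext (Units.ext (hE.isField.mul_comm _ _))
    rwa [h]
  refine ⟨hE, (inf_eq_left.2 hEM).symm, hΓ, fun a ha => ?_, hnormal,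
    UnitarySK.nonempty_SK₁_mulEquiv hE Z hZ hdecomp hP⟩
  -- The inclusion is `Σ_τ(E) ⊆ Σ'_τ(E)` intersected with `E₀^*`.
  rw [← hP] at ha
  exact (UnitarySK.unitsE₀_mem_nrdSubgroup_iff hE a).1
    (UnitarySK.symSubgroup_le_nrdSubgroup 𝒜 ha)
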